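/- Let $p>2$ be a prime, let $u\in\mathbf F_p$ be a non-square and put $G=\mathrm{GL}_2(\mathbf F_p)$. Let $Z\subset G$ be the group of scalar matrices, $U$ the group of matrices $\begin{pmatrix}1&x\\0&1\end{pmatrix}$, $T$ the group of diagonal matrices, and $$T'=\Big\{\begin{pmatrix}a&bu\\b&a\end{pmatrix}\in G : a,b\in\mathbf F_p\Big\};$$ let $N$ and $N'$ be the normalizers of $T$ and $T'$ in $G$. Then $\mathbf F_{p^2}=T'\cup\{0\}$ is a field with $p^2$ elements; write $\mathrm N(y)=\det y$ and $\mathrm{Tr}(y)=\operatorname{tr} y$ for its norm and trace to $\mathbf F_p$. The group $T'/Z$ is cyclic of even order $p+1$. Let $K$ be a field of characteristic $0$ and let $\theta:T'/Z\to K^*$ be a character with $\theta^2\neq 1$ (for instance, $K=\mathbf Q(\theta)$ is the field generated by the values of $\theta$). Call $\theta$ odd if it is not $1$ on the element of order $2$ of $T'/Z$. Let $V_\theta$ be the space of functions $\phi:\mathbf F_p\to K$ modulo the constant functions. An upper triangular $\sigma\in G$ acts on $V_\theta$ by $(\sigma\phi)(x)=\phi(\sigma^{-1}x)$, where $\begin{pmatrix}a&b\\0&d\end{pmatrix}x=(ax+b)/d$,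 and $w=\begin{pmatrix}0&1\\-1&0\end{pmatrix}$ acts by $$w\phi=-\frac1p\sum_{y\in\mathbf F_{p^2}^*}\theta(y)\begin{pmatrix}\mathrm N(y)&\mathrm{Tr}(y)\\0&1\end{pmatrix}\phi .$$ These formulas determine a representation of $G$ on $V_\theta$, the cuspidal representation associated to $\theta$. For $r\in\mathbf F_p$ let $e_r\in V_\theta$ be the class of the characteristic function of $r$. Then: (a) the subspace of $U$-invariants of $V_\theta$ is zero; (b) the subspace of $T$-invariants of $V_\theta$ is spanned by $e_0$, and $N$ fixes every element of it if and only if $\theta$ is odd; (c) the subspace of $T'$-invariants of $V_\theta$ has dimension $1$; there is an $r\in\mathbf F_p^*$ for which it is spanned by $$p\,e_r-\sum_{m\in\mathbf F_p}\ \sum_{y\in\mathbf F_{p^2}^*}\theta(y)\,e_{\frac{(m+r)\mathrm N(y)}{m^2-u}+\mathrm{Tr}(y)+m};$$ and $N'$ fixes every element of it if and only if $\theta$ is odd. -/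

import Mathlib

namespace CuspidalModel

open scoped MatrixGroups

/-! ### Subgroups of the group of invertible two by two matrices over the prime field -/

/-- The scalar matrices `Z`. -/
def scalars (p : ℕ) [Fact p.Prime] : Subgroup (GL (Fin 2) (ZMod p)) :=
  (Matrix.GeneralLinearGroup.scalar (Fin 2)).range

/-- The unipotent group `U` of the matrices `(1 x; 0 1)`. -/
def unipotents (p : ℕ) [Fact p.Prime] : Subgroup (GL (Fin 2) (ZMod p)) where
  carrier := {g | g 0 0 = 1 ∧ g 1 0 = 0 ∧ g 1 1 = 1}
  one_mem' := by simp
  mul_mem' := by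
    rintro g h ⟨h1, h2, h3⟩ ⟨k1, k2, k3⟩
    simp [Matrix.mul_apply, Fin.sum_univ_two, h1, h2, h3, k1, k2, k3]
  inv_mem' := by
    rintro g ⟨h1, h2, h3⟩
    simp [Matrix.coe_units_inv, Matrix.inv_def, Matrix.adjugate_fin_two, Matrix.det_fin_two,
      h1, h2, h3]

/-- The split torus `T` of the diagonal matrices. -/
def splitTorus (p : ℕ) [Fact p.Prime] : Subgroup (GL (Fin 2) (ZMod p)) where
  carrier := {g | g 0 1 = 0 ∧ g 1 0 = 0}
  one_mem' := by simp
  mul_mem' := by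
    rintro g h ⟨h1, h2⟩ ⟨k1, k2⟩
    simp [Matrix.mul_apply, Fin.sum_univ_two, h1, h2, k1, k2]
  inv_mem' := by
    rintro g ⟨h1, h2⟩
    simp [Matrix.coe_units_inv, Matrix.inv_def, Matrix.adjugate_fin_two, h1, h2]

/-- The torus `T'` of the invertible matrices `(a bu; b a)`; it is non-split when `u` is not a
square. -/
def nonsplitTorus (p : ℕ) [Fact p.Prime] (u : ZMod p) : Subgroup (GL (Fin 2) (ZMod p)) where
  carrier := {g | g 1 1 = g 0 0 ∧ g 0 1 = g 1 0 * u}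
  one_mem' := by simp
  mul_mem' := by
    rintro g h ⟨h1, h2⟩ ⟨k1, k2⟩
    simp only [Set.mem_ofPred_eq, Matrix.GeneralLinearGroup.coe_mul, Matrix.mul_apply,
      Fin.sum_univ_two, h1, h2, k1, k2]
    constructor <;> ring
  inv_mem' := by
    rintro g ⟨h1, h2⟩
    simp [Matrix.coe_units_inv, Matrix.inv_def, Matrix.adjugate_fin_two, h1, h2]
    ring

instance scalars_normal (p : ℕ) [Fact p.Prime] : (scalars p).Normal := by
  rw [scalars, ← Matrix.GeneralLinearGroup.center_eq_range_scalar]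
  infer_instance

noncomputable instance (p : ℕ) [Fact p.Prime] (u : ZMod p) : Fintype (nonsplitTorus p u) :=
  Fintype.ofFinite _

/-- The quotient `T'/Z`. -/
abbrev TorusModScalars (p : ℕ) [Fact p.Prime] (u : ZMod p) : Type :=
  nonsplitTorus p u ⧸ (scalars p).subgroupOf (nonsplitTorus p u)

/-- A character of `T'/Z` is odd if it is nontrivial on the (unique) element of order two. -/
def IsOdd {p : ℕ} [Fact p.Prime] {u : ZMod p} {K : Type*} [Field K]
    (θ : TorusModScalars p u →* Kˣ) : Prop :=
  ∀ t : TorusModScalars p u, orderOf t = 2 → θ t ≠ 1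

/-! ### The underlying space of the model -/

/-- The line of constant functions on the prime field. -/
def constants (p : ℕ) (K : Type*) [Field K] : Submodule K (ZMod p → K) :=
  Submodule.span K {fun _ => (1 : K)}

/-- The space of functions on the prime field modulo the constant functions. -/
abbrev Model (p : ℕ) (K : Type*) [Field K] : Type _ :=
  (ZMod p → K) ⧸ constants p K

/-- The class `e_r` of the characteristic function of `r`. -/
def e {p : ℕ} (K : Type*) [Field K] (r : ZMod p) : Model p K :=
  (constants p K).mkQ (Pi.single r 1)

/-- The operator `φ ↦ (x ↦ φ(σ⁻¹ x))` on functions, for the upper triangular matrix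
`σ = (a b; 0 d)`, which acts on the prime field by `σ x = (a x + b) / d`, so that
`σ⁻¹ x = (d x - b) / a`. -/
def borelFun {p : ℕ} (K : Type*) [Field K] [Fact p.Prime] (a b d : ZMod p) :
    (ZMod p → K) →ₗ[K] (ZMod p → K) :=
  LinearMap.funLeft K K (fun x => (d * x - b) / a)

theorem constants_le_comap_borelFun {p : ℕ} (K : Type*) [Field K] [Fact p.Prime]
    (a b d : ZMod p) : constants p K ≤ (constants p K).comap (borelFun K a b d) := by
  rw [constants, Submodule.span_le]
  rintro _ rfl
  exact Submodule.subset_span rfl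

/-- The action of the upper triangular matrix `(a b; 0 d)` on functions modulo constants. -/
def borel {p : ℕ} (K : Type*) [Field K] [Fact p.Prime] (a b d : ZMod p) :
    Module.End K (Model p K) :=
  (constants p K).mapQ (constants p K) (borelFun K a b d) (constants_le_comap_borelFun K a b d)

section

variable {p : ℕ} [Fact p.Prime] {u : ZMod p} {K : Type*} [Field K]

/-- The value `θ(y)` in `K` of a character of `T'/Z` at an element `y` of `T'`. -/
def charValue (θ : TorusModScalars p u →* Kˣ) (y : nonsplitTorus p u) : K :=
  (θ (QuotientGroup.mk y) : K)

/-- The norm of an element of `T'`, the multiplicative group of the field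
`{(a bu; b a)}` with `p ^ 2` elements: the determinant `a ^ 2 - u b ^ 2`. -/
def nm (y : nonsplitTorus p u) : ZMod p := (y.1 : Matrix (Fin 2) (Fin 2) (ZMod p)).det

/-- The trace `2 a` of an element `(a bu; b a)` of `T'`. -/
def tr (y : nonsplitTorus p u) : ZMod p := (y.1 : Matrix (Fin 2) (Fin 2) (ZMod p)).trace

/-- The action of `w = (0 1; -1 0)`:
`w φ = -(1/p) ∑_y θ(y) (N(y) Tr(y); 0 1) φ`, the sum being over `T'`. -/
noncomputable def wAct (θ : TorusModScalars p u →* Kˣ) : Module.End K (Model p K) :=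
  (-(1 / (p : K))) • ∑ y : nonsplitTorus p u, charValue θ y • borel K (nm y) (tr y) 1

open Classical in
/-- The action of an invertible matrix `g = (a b; c d)` of determinant `D`. If `c = 0` it is the
action of upper triangular matrices. Otherwise it is given by the Bruhat decomposition
`g = (1 a/c; 0 1) w (-c -d; 0 -D/c)`. -/
noncomputable def act (θ : TorusModScalars p u →* Kˣ) (g : GL (Fin 2) (ZMod p)) :
    Module.End K (Model p K) :=
  if g 1 0 = 0 then borel K (g 0 0) (g 0 1) (g 1 1)
  else borel K 1 (g 0 0 / g 1 0) 1 * wAct θ *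
    borel K (-g 1 0) (-g 1 1) (-(g.1.det / g 1 0))

/-! ### The formulas define a representation -/

theorem end_ext {f g : Module.End K (Model p K)} (h : ∀ r, f (e K r) = g (e K r)) : f = g := by
  apply Submodule.linearMap_qext
  refine LinearMap.pi_ext' fun r => LinearMap.ext_ring ?_
  exact h r

theorem sum_e : ∑ r : ZMod p, e K r = 0 := by
  simp only [e]
  rw [← map_sum, Finset.univ_sum_single (fun _ : ZMod p => (1 : K))]
  exact (Submodule.Quotient.mk_eq_zero _).2 (Submodule.subset_span rfl)

theorem borel_e {a b d : ZMod p} (ha : a ≠ 0) (hd : d ≠ 0) (r : ZMod p) :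
    borel K a b d (e K r) = e K ((a * r + b) / d) := by
  rw [borel, e, Submodule.mkQ_apply, Submodule.mapQ_apply, e, Submodule.mkQ_apply]
  congr 1
  funext x
  rw [borelFun, LinearMap.funLeft_apply, Pi.single_apply, Pi.single_apply]
  congr 1
  rw [div_eq_iff ha, eq_div_iff hd, eq_iff_iff]
  constructor <;> intro h <;> linear_combination h

theorem borel_congr {a b d a' b' d' : ZMod p} (ha : a ≠ 0) (hd : d ≠ 0) (ha' : a' ≠ 0)
    (hd' : d' ≠ 0) (h1 : a / d = a' / d') (h2 : b / d = b' / d') :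
    borel K a b d = borel K a' b' d' := by
  refine end_ext fun r => ?_
  rw [borel_e ha hd, borel_e ha' hd']
  congr 1
  rw [add_div, add_div, mul_div_right_comm, mul_div_right_comm, h1, h2]

theorem borel_mul {a b d a' b' d' : ZMod p} (ha : a ≠ 0) (hd : d ≠ 0) (ha' : a' ≠ 0)
    (hd' : d' ≠ 0) :
    borel K a b d * borel K a' b' d' = borel K (a * a') (a * b' + b * d') (d * d') := by
  refine end_ext fun r => ?_
  rw [Module.End.mul_apply, borel_e ha' hd', borel_e ha hd,
    borel_e (mul_ne_zero ha ha') (mul_ne_zero hd hd')]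
  congr 1
  field_simp
  ring

theorem borel_one : borel K (1 : ZMod p) 0 1 = 1 := by
  refine end_ext fun r => ?_
  rw [borel_e one_ne_zero one_ne_zero]
  simp

theorem sum_e_affine {k : ZMod p} (hk : k ≠ 0) (c : ZMod p) :
    ∑ x : ZMod p, e K (k * x + c) = 0 := by
  rw [← sum_e (p := p) (K := K)]
  refine Fintype.sum_equiv ((Equiv.mulLeft₀ k hk).trans (Equiv.addRight c)) _ _ ?_
  simp

theorem nm_eq (y : nonsplitTorus p u) : nm y = y.1 0 0 ^ 2 - u * y.1 1 0 ^ 2 := by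
  obtain ⟨h1, h2⟩ := y.2
  rw [nm, Matrix.det_fin_two, h1, h2]
  ring

theorem tr_eq (y : nonsplitTorus p u) : tr y = 2 * y.1 0 0 := by
  obtain ⟨h1, h2⟩ := y.2
  rw [tr, Matrix.trace_fin_two, h1]
  ring

theorem nm_ne_zero (y : nonsplitTorus p u) : nm y ≠ 0 :=
  (Matrix.isUnits_det_units y.1).ne_zero

theorem nm_mul (y z : nonsplitTorus p u) : nm (y * z) = nm y * nm z := by
  simp [nm]

theorem coord_mul (y z : nonsplitTorus p u) :
    (y * z).1 0 0 = y.1 0 0 * z.1 0 0 + u * y.1 1 0 * z.1 1 0 ∧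
      (y * z).1 1 0 = y.1 0 0 * z.1 1 0 + y.1 1 0 * z.1 0 0 := by
  obtain ⟨h1, h2⟩ := y.2
  simp only [Subgroup.coe_mul, Matrix.GeneralLinearGroup.coe_mul, Matrix.mul_apply,
    Fin.sum_univ_two, h1, h2]
  constructor <;> ring

theorem wAct_e (θ : TorusModScalars p u →* Kˣ) (r : ZMod p) :
    wAct θ (e K r) = (-(1 / (p : K))) •
      ∑ y : nonsplitTorus p u, charValue θ y • e K (nm y * r + tr y) := by
  simp only [wAct, LinearMap.smul_apply, LinearMap.sum_apply]
  simp [borel_e (nm_ne_zero _) one_ne_zero]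

theorem charValue_mul (θ : TorusModScalars p u →* Kˣ) (y z : nonsplitTorus p u) :
    charValue θ (y * z) = charValue θ y * charValue θ z := by
  simp [charValue]

/-- The element `(a bu; b a)` of `T'`. -/
def mkT (a b : ZMod p) (h : a ^ 2 - u * b ^ 2 ≠ 0) : nonsplitTorus p u :=
  ⟨Matrix.GeneralLinearGroup.mkOfDetNeZero !![a, b * u; b, a]
    (by rw [Matrix.det_fin_two_of]; convert h using 1; ring), by
      constructor <;> simp [Matrix.GeneralLinearGroup.mkOfDetNeZero]⟩

theorem mkT_zero (a b : ZMod p) (h : a ^ 2 - u * b ^ 2 ≠ 0) : (mkT a b h).1 0 0 = a := by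
  simp [mkT, Matrix.GeneralLinearGroup.mkOfDetNeZero]

theorem mkT_one (a b : ZMod p) (h : a ^ 2 - u * b ^ 2 ≠ 0) : (mkT a b h).1 1 0 = b := by
  simp [mkT, Matrix.GeneralLinearGroup.mkOfDetNeZero]

theorem torus_ext {y z : nonsplitTorus p u} (h0 : y.1 0 0 = z.1 0 0) (h1 : y.1 1 0 = z.1 1 0) :
    y = z := by
  obtain ⟨a1, a2⟩ := y.2
  obtain ⟨b1, b2⟩ := z.2
  refine Subtype.ext (Matrix.GeneralLinearGroup.ext fun i j => ?_)
  fin_cases i <;> fin_cases j <;> simp_all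

theorem form_ne_zero (hu : ¬IsSquare u) {a b : ZMod p} (h : a ≠ 0 ∨ b ≠ 0) :
    a ^ 2 - u * b ^ 2 ≠ 0 := by
  intro h0
  by_cases hb : b = 0
  · subst hb
    simp_all
  · apply hu
    refine ⟨a / b, ?_⟩
    field_simp
    linear_combination -h0

theorem two_ne_zero_of (hu : ¬IsSquare u) : (2 : ZMod p) ≠ 0 := by
  intro h
  apply hu
  have h2 : p = 2 := by
    have h3 : ((2 : ℕ) : ZMod p) = 0 := by exact_mod_cast h
    rw [ZMod.natCast_eq_zero_iff] at h3
    exact (Nat.prime_dvd_prime_iff_eq Fact.out Nat.prime_two).1 h3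
  have h4 : ∀ v : ZMod 2, IsSquare v := by
    clear * -
    decide
  subst h2
  exact h4 u

/-- A sum over the field with `p ^ 2` elements. -/
theorem sum_torus {M : Type*} [AddCommGroup M] (hu : ¬IsSquare u) (f : ZMod p → ZMod p → M) :
    ∑ a, ∑ b, f a b = f 0 0 + ∑ z : nonsplitTorus p u, f (z.1 0 0) (z.1 1 0) := by
  classical
  rw [← Fintype.sum_prod_type', Fintype.sum_eq_add_sum_compl (0 : ZMod p × ZMod p)]
  congr 1
  symm
  refine Finset.sum_bij (fun z _ => (z.1 0 0, z.1 1 0)) ?_ ?_ ?_ ?_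
  · intro z _
    have h := nm_ne_zero z
    rw [nm_eq] at h
    simp only [Finset.mem_compl, Finset.mem_singleton, Prod.ext_iff]
    rintro ⟨h1, h2⟩
    simp_all
  · intro y _ z _ h
    exact torus_ext (Prod.ext_iff.1 h).1 (Prod.ext_iff.1 h).2
  · rintro ⟨a, b⟩ h
    have h' : a ≠ 0 ∨ b ≠ 0 := by
      by_contra! hh
      simp_all
    exact ⟨mkT a b (form_ne_zero hu h'), Finset.mem_univ _, by rw [mkT_zero, mkT_one]⟩
  · intro z _
    rfl

theorem charValue_of_scalar (θ : TorusModScalars p u →* Kˣ) (y : nonsplitTorus p u)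
    (hy : y.1 1 0 = 0) : charValue θ y = 1 := by
  have h : (QuotientGroup.mk y : TorusModScalars p u) = 1 := by
    rw [QuotientGroup.eq_one_iff, Subgroup.mem_subgroupOf, scalars, MonoidHom.mem_range]
    have h0 := nm_ne_zero y
    rw [nm_eq, hy] at h0
    have h1 : y.1 0 0 ≠ 0 := by
      intro h
      simp [h] at h0
    refine ⟨Units.mk0 _ h1, Matrix.GeneralLinearGroup.ext fun i j => ?_⟩
    obtain ⟨a1, a2⟩ := y.2
    fin_cases i <;> fin_cases j <;> simp_all [Matrix.GeneralLinearGroup.scalar]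
  rw [charValue, h]
  simp

/-- The scalar matrix with entry `a`, as an element of `T'`. -/
def mkScalar (a : ZMod p) (ha : a ≠ 0) : nonsplitTorus p u :=
  mkT a 0 (by simpa using ha)

theorem charValue_mkScalar (θ : TorusModScalars p u →* Kˣ) (a : ZMod p) (ha : a ≠ 0) :
    charValue θ (mkScalar a ha) = 1 :=
  charValue_of_scalar θ _ (mkT_one _ _ _)

theorem sum_norm (θ : TorusModScalars p u →* Kˣ) (hθ : θ ^ 2 ≠ 1) (f : ZMod p → Model p K) :
    ∑ y : nonsplitTorus p u, charValue θ y • f (nm y) = 0 := by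
  obtain ⟨q, hq⟩ : ∃ q, θ q ^ 2 ≠ 1 := by
    by_contra! h
    exact hθ (MonoidHom.ext h)
  obtain ⟨y, rfl⟩ := QuotientGroup.mk_surjective q
  have hy := nm_ne_zero y
  set t : nonsplitTorus p u := y * y * mkScalar (nm y)⁻¹ (inv_ne_zero hy) with ht
  have h1 : nm t = 1 := by
    rw [ht, nm_mul, nm_mul, nm_eq (mkScalar _ _), mkScalar, mkT_zero, mkT_one]
    field_simp
    simp
  have h2 : charValue θ t ≠ 1 := by
    rw [ht, charValue_mul, charValue_mul, charValue_mkScalar, mul_one, ← pow_two]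
    intro h
    exact hq (Units.ext (by simpa [charValue] using h))
  clear_value t
  set S := ∑ y : nonsplitTorus p u, charValue θ y • f (nm y) with hS
  have h3 : charValue θ t • S = S := by
    conv_rhs => rw [hS, ← Equiv.sum_comp (Equiv.mulLeft t)]
    rw [hS, Finset.smul_sum]
    refine Finset.sum_congr rfl fun z _ => ?_
    simp only [Equiv.coe_mulLeft, charValue_mul, nm_mul, h1, one_mul, mul_smul]
  have h4 : (charValue θ t - 1) • S = 0 := by rw [sub_smul, h3, one_smul, sub_self]
  exact (smul_eq_zero.1 h4).resolve_left (sub_ne_zero.2 h2)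

theorem exists_nm (hu : ¬IsSquare u) {n : ZMod p} (hn : n ≠ 0) :
    ∃ y : nonsplitTorus p u, nm y = n := by
  classical
  have hp : Fintype.card (ZMod p) % 2 = 1 := by
    rw [ZMod.card]
    refine (Nat.Prime.eq_two_or_odd (Fact.out : p.Prime)).resolve_left ?_
    rintro rfl
    exact two_ne_zero_of hu rfl
  have hu0 : u ≠ 0 := by
    rintro rfl
    exact hu (IsSquare.zero)
  obtain ⟨a, b, hab⟩ := FiniteField.exists_root_sum_quadratic
    (f := (Polynomial.X ^ 2 - Polynomial.C n : Polynomial (ZMod p)))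
    (g := Polynomial.C (-u) * Polynomial.X ^ 2)
    (Polynomial.degree_X_pow_sub_C (by decide) _)
    (Polynomial.degree_C_mul_X_pow 2 (neg_ne_zero.2 hu0)) hp
  simp only [Polynomial.eval_sub, Polynomial.eval_pow, Polynomial.eval_X, Polynomial.eval_C,
    Polynomial.eval_mul] at hab
  have h : a ^ 2 - u * b ^ 2 = n := by linear_combination hab
  refine ⟨mkT a b (h ▸ hn), ?_⟩
  rw [nm_eq, mkT_zero, mkT_one, h]

theorem card_torus (hu : ¬IsSquare u) :
    (Fintype.card (nonsplitTorus p u) : ℤ) = (p : ℤ) ^ 2 - 1 := by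
  have h := sum_torus hu (fun _ _ => (1 : ℤ))
  simp only [Finset.sum_const, Finset.card_univ, ZMod.card] at h
  simp only [nsmul_eq_mul, mul_one] at h
  linear_combination -h

theorem sum_e_norm [CharZero K] (hu : ¬IsSquare u) {x : ZMod p} (hx : x ≠ 0) (c : ZMod p) :
    ∑ z : nonsplitTorus p u, e K (x * nm z + c) = (-((p : K) + 1)) • e K c := by
  classical
  have h1 : ∀ k : ZMod p, k ≠ 0 → ∑ z : nonsplitTorus p u, e K (k * nm z + c)
      = ∑ z : nonsplitTorus p u, e K (x * nm z + c) := by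
    intro k hk
    obtain ⟨y, hy⟩ := exists_nm hu (div_ne_zero hx hk)
    rw [← Equiv.sum_comp (Equiv.mulLeft y)]
    refine Finset.sum_congr rfl fun z _ => ?_
    rw [Equiv.coe_mulLeft, nm_mul, hy]
    congr 1
    field_simp
  have h2 : ∑ k : ZMod p, ∑ z : nonsplitTorus p u, e K (k * nm z + c) = 0 := by
    rw [Finset.sum_comm]
    refine Finset.sum_eq_zero fun z _ => ?_
    rw [← sum_e_affine (K := K) (nm_ne_zero z) c]
    exact Finset.sum_congr rfl fun k _ => by rw [mul_comm]
  rw [Fintype.sum_eq_add_sum_compl (0 : ZMod p)] at h2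
  rw [Finset.sum_congr rfl (fun k hk => h1 k (by simpa using hk))] at h2
  simp only [zero_mul, zero_add, Finset.sum_const, Finset.card_univ, Finset.card_compl,
    Finset.card_singleton, ZMod.card] at h2
  have hp1 : 1 ≤ p := (Fact.out : p.Prime).one_lt.le
  have hc : (Fintype.card (nonsplitTorus p u) : K) = (p : K) ^ 2 - 1 := by
    have := congrArg (Int.cast (R := K)) (card_torus hu)
    push_cast at this
    exact this
  rw [← Nat.cast_smul_eq_nsmul K, ← Nat.cast_smul_eq_nsmul K, hc, Nat.cast_sub hp1,
    Nat.cast_one] at h2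
  have hp0 : (p : K) - 1 ≠ 0 := by
    rw [sub_ne_zero]
    exact_mod_cast (Fact.out : p.Prime).one_lt.ne'
  have h3 : ((p : K) - 1) • (∑ z : nonsplitTorus p u, e K (x * nm z + c)
      - (-((p : K) + 1)) • e K c) = 0 := by
    rw [← h2]
    module
  exact sub_eq_zero.1 ((smul_eq_zero.1 h3).resolve_left hp0)

/-- A quadratic sum with nonzero leading coefficient. -/
theorem quadratic_sum [CharZero K] (hu : ¬IsSquare u) {x : ZMod p} (hx : x ≠ 0)
    (A B c : ZMod p) :
    ∑ a : ZMod p, ∑ b : ZMod p,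
      e K (x * (a ^ 2 - u * b ^ 2) + 2 * (A * a - u * B * b) + c)
      = (-(p : K)) • e K (c - (A ^ 2 - u * B ^ 2) / x) := by
  have h1 : ∑ a : ZMod p, ∑ b : ZMod p,
      e K (x * (a ^ 2 - u * b ^ 2) + 2 * (A * a - u * B * b) + c)
      = ∑ a : ZMod p, ∑ b : ZMod p,
        e K (x * (a ^ 2 - u * b ^ 2) + (c - (A ^ 2 - u * B ^ 2) / x)) := by
    refine Fintype.sum_equiv (Equiv.addRight (A / x)) _ _ fun a => ?_
    refine Fintype.sum_equiv (Equiv.addRight (B / x)) _ _ fun b => ?_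
    simp only [Equiv.coe_addRight]
    congr 1
    field_simp
    ring
  rw [h1, sum_torus hu]
  simp only [← nm_eq]
  rw [sum_e_norm hu hx]
  simp only [ne_eq, OfNat.ofNat_ne_zero, not_false_eq_true, zero_pow, mul_zero, sub_zero, zero_add]
  module

theorem linear_sum (hu : ¬IsSquare u) {A B : ZMod p} (h : A ≠ 0 ∨ B ≠ 0) (c : ZMod p) :
    ∑ a : ZMod p, ∑ b : ZMod p, e K (2 * (A * a - u * B * b) + c) = 0 := by
  have h2 := two_ne_zero_of hu
  have hu0 : u ≠ 0 := by
    rintro rfl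
    exact hu (IsSquare.zero)
  rcases h with h | h
  · rw [Finset.sum_comm]
    refine Finset.sum_eq_zero fun b _ => ?_
    rw [← sum_e_affine (K := K) (mul_ne_zero h2 h) (c - 2 * u * B * b)]
    exact Finset.sum_congr rfl fun a _ => by congr 1; ring
  · refine Finset.sum_eq_zero fun a _ => ?_
    rw [← sum_e_affine (K := K) (neg_ne_zero.2 (mul_ne_zero (mul_ne_zero h2 hu0) h))
      (c + 2 * A * a)]
    exact Finset.sum_congr rfl fun b _ => by congr 1; ring

theorem w_borel_w_e (hu : ¬IsSquare u) (θ : TorusModScalars p u →* Kˣ) (hθ : θ ^ 2 ≠ 1)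
    (x s : ZMod p) :
    (wAct θ * borel K 1 x 1 * wAct θ) (e K s) = (1 / (p : K) ^ 2) •
      ∑ t : nonsplitTorus p u, charValue θ t • ∑ a : ZMod p, ∑ b : ZMod p,
        e K (x * (a ^ 2 - u * b ^ 2) + 2 * ((1 + t.1 0 0) * a - u * t.1 1 0 * b) + nm t * s) := by
  rw [Module.End.mul_apply, Module.End.mul_apply, wAct_e]
  simp only [map_smul, map_sum]
  have h1 : ∀ y : nonsplitTorus p u, charValue θ y • (wAct θ) ((borel K 1 x 1)
      (e K (nm y * s + tr y))) = (-(1 / (p : K))) • ∑ z : nonsplitTorus p u,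
        charValue θ (y * z) • e K (x * nm z + 2 * (1 + (y * z).1 0 0) * z.1 0 0
          - 2 * u * (y * z).1 1 0 * z.1 1 0 + nm (y * z) * s) := by
    intro y
    rw [borel_e one_ne_zero one_ne_zero, wAct_e, smul_comm, Finset.smul_sum]
    congr 1
    refine Finset.sum_congr rfl fun z _ => ?_
    rw [smul_smul, charValue_mul]
    congr 2
    rw [(coord_mul y z).1, (coord_mul y z).2, nm_mul, tr_eq, tr_eq, nm_eq z, nm_eq y]
    field_simp
    ring
  rw [Finset.sum_congr rfl fun y _ => h1 y, ← Finset.smul_sum, smul_smul, Finset.sum_comm]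
  have h2 : ∀ z : nonsplitTorus p u, ∑ y : nonsplitTorus p u,
        charValue θ (y * z) • e K (x * nm z + 2 * (1 + (y * z).1 0 0) * z.1 0 0
          - 2 * u * (y * z).1 1 0 * z.1 1 0 + nm (y * z) * s)
      = ∑ t : nonsplitTorus p u, charValue θ t • e K (x * nm z + 2 * (1 + t.1 0 0) * z.1 0 0
          - 2 * u * t.1 1 0 * z.1 1 0 + nm t * s) := fun z =>
    Equiv.sum_comp (Equiv.mulRight z) (fun t : nonsplitTorus p u => charValue θ t •
      e K (x * nm z + 2 * (1 + t.1 0 0) * z.1 0 0 - 2 * u * t.1 1 0 * z.1 1 0 + nm t * s))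
  rw [Finset.sum_congr rfl fun z _ => h2 z, Finset.sum_comm]
  have h3 := sum_norm θ hθ (fun n => e K (n * s))
  have h4 : ∀ t : nonsplitTorus p u, charValue θ t • ∑ a : ZMod p, ∑ b : ZMod p,
        e K (x * (a ^ 2 - u * b ^ 2) + 2 * ((1 + t.1 0 0) * a - u * t.1 1 0 * b) + nm t * s)
      = charValue θ t • e K (nm t * s) + ∑ z : nonsplitTorus p u, charValue θ t •
        e K (x * nm z + 2 * (1 + t.1 0 0) * z.1 0 0 - 2 * u * t.1 1 0 * z.1 1 0 + nm t * s) := by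
    intro t
    rw [sum_torus hu, smul_add, Finset.smul_sum]
    congr 1
    · congr 2
      ring
    · refine Finset.sum_congr rfl fun z _ => ?_
      rw [nm_eq z]
      congr 2
      ring
  rw [Finset.sum_congr rfl fun t _ => h4 t, Finset.sum_add_distrib, h3, zero_add]
  congr 1
  ring

theorem w_mul_w [CharZero K] (hu : ¬IsSquare u) (θ : TorusModScalars p u →* Kˣ)
    (hθ : θ ^ 2 ≠ 1) : wAct θ * wAct θ = 1 := by
  classical
  have hp0 : (p : K) ≠ 0 := Nat.cast_ne_zero.2 (Fact.out : p.Prime).ne_zero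
  refine end_ext fun s => ?_
  have h := w_borel_w_e hu θ hθ 0 s
  rw [borel_one, mul_one] at h
  rw [h, Finset.sum_eq_single (mkScalar (-1) (neg_ne_zero.2 one_ne_zero))]
  · rw [charValue_mkScalar]
    simp only [mkScalar, mkT_zero, mkT_one, nm_eq]
    simp [← Nat.cast_smul_eq_nsmul K, smul_smul]
    rw [show (((p : K) ^ 2)⁻¹ * ((p : K) * (p : K))) = 1 by field_simp, one_smul]
  · intro t _ ht
    simp only [zero_mul, zero_add]
    rw [linear_sum hu, smul_zero]
    by_contra! hh
    apply ht
    apply torus_ext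
    · rw [mkScalar, mkT_zero]
      linear_combination hh.1
    · rw [mkScalar, mkT_one, hh.2]
  · simp

theorem w_borel_w [CharZero K] (hu : ¬IsSquare u) (θ : TorusModScalars p u →* Kˣ)
    (hθ : θ ^ 2 ≠ 1) {x : ZMod p} (hx : x ≠ 0) :
    wAct θ * borel K 1 x 1 * wAct θ
      = borel K 1 (-1 / x) 1 * wAct θ * borel K (x ^ 2) (-x) 1 := by
  have hp0 : (p : K) ≠ 0 := Nat.cast_ne_zero.2 (Fact.out : p.Prime).ne_zero
  refine end_ext fun s => ?_
  rw [w_borel_w_e hu θ hθ, Module.End.mul_apply, Module.End.mul_apply,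
    borel_e (pow_ne_zero 2 hx) one_ne_zero, wAct_e]
  simp only [map_smul, map_sum, quadratic_sum hu hx, borel_e (one_ne_zero) (one_ne_zero)]
  rw [← Equiv.sum_comp (Equiv.mulRight (mkScalar (-x) (neg_ne_zero.2 hx))), Finset.smul_sum,
    Finset.smul_sum]
  refine Finset.sum_congr rfl fun t _ => ?_
  rw [Equiv.coe_mulRight, charValue_mul, charValue_mkScalar, mul_one, smul_smul, smul_smul,
    smul_smul]
  congr 1
  · field_simp
  · rw [(coord_mul t _).1, (coord_mul t _).2, nm_mul, tr_eq, nm_eq t, nm_eq, mkScalar, mkT_zero,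
      mkT_one]
    congr 1
    field_simp
    ring

theorem w_borel_diag (θ : TorusModScalars p u →* Kˣ) {k : ZMod p} (hk : k ≠ 0) :
    wAct θ * borel K k 0 1 = borel K 1 0 k * wAct θ := by
  refine end_ext fun s => ?_
  rw [Module.End.mul_apply, Module.End.mul_apply, borel_e hk one_ne_zero, wAct_e, wAct_e,
    ← Equiv.sum_comp (Equiv.mulRight (mkScalar k⁻¹ (inv_ne_zero hk)))]
  simp only [map_smul, map_sum, borel_e one_ne_zero hk]
  congr 1
  refine Finset.sum_congr rfl fun t _ => ?_
  rw [Equiv.coe_mulRight, charValue_mul, charValue_mkScalar, mul_one]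
  congr 2
  rw [tr_eq, (coord_mul t _).1, nm_mul, tr_eq, nm_eq (mkScalar _ _), mkScalar, mkT_zero, mkT_one]
  field_simp
  ring

theorem act_of_eq_zero (θ : TorusModScalars p u →* Kˣ) {g : GL (Fin 2) (ZMod p)}
    (h : g 1 0 = 0) : act θ g = borel K (g 0 0) (g 0 1) (g 1 1) := by
  rw [act, if_pos h]

theorem act_of_ne_zero (θ : TorusModScalars p u →* Kˣ) {g : GL (Fin 2) (ZMod p)}
    (h : g 1 0 ≠ 0) : act θ g = borel K 1 (g 0 0 / g 1 0) 1 * wAct θ *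
      borel K (-g 1 0) (-g 1 1) (-(g.1.det / g 1 0)) := by
  rw [act, if_neg h]

/-- Moving a diagonal matrix through `w`. -/
theorem sandwich (θ : TorusModScalars p u →* Kˣ) {a b d a' b' d' : ZMod p} (ha : a ≠ 0)
    (hd : d ≠ 0) (ha' : a' ≠ 0) (hd' : d' ≠ 0) :
    borel K a b d * wAct θ * borel K a' b' d'
      = borel K 1 (b / d) 1 * wAct θ * borel K (d * a') (d * b') (a * d') := by
  have hk : a / d ≠ 0 := div_ne_zero ha hd
  have hk' : d / a ≠ 0 := div_ne_zero hd ha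
  have h1 : borel K a b d = borel K 1 (b / d) 1 * borel K 1 0 (d / a) := by
    rw [borel_mul one_ne_zero one_ne_zero one_ne_zero hk']
    apply borel_congr ha hd <;> first | simpa using hk' | (field_simp; try ring)
  have h2 : borel K (d * a') (d * b') (a * d')
      = borel K (d / a) 0 1 * borel K a' b' d' := by
    rw [borel_mul hk' one_ne_zero ha' hd']
    apply borel_congr (mul_ne_zero hd ha') (mul_ne_zero ha hd') (mul_ne_zero hk' ha')
      (by simpa using hd') <;> (field_simp; try ring)
  rw [h1, h2, mul_assoc (borel K 1 (b / d) 1), ← w_borel_diag θ hk']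
  simp only [mul_assoc]

theorem triple_congr {R : Type*} [Mul R] {X X' W P P' : R} (h1 : X = X') (h2 : P = P') :
    X * W * P = X' * W * P' := by rw [h1, h2]

theorem act_one (θ : TorusModScalars p u →* Kˣ) : act θ 1 = 1 := by
  rw [act_of_eq_zero θ (by simp)]
  simp [borel_one]

theorem act_mul [CharZero K] (hu : ¬IsSquare u) (θ : TorusModScalars p u →* Kˣ)
    (hθ : θ ^ 2 ≠ 1) (g h : GL (Fin 2) (ZMod p)) : act θ (g * h) = act θ g * act θ h := by
  have hD : g.1.det ≠ 0 := (Matrix.isUnits_det_units g).ne_zero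
  have hE : h.1.det ≠ 0 := (Matrix.isUnits_det_units h).ne_zero
  have hDE : (g * h).1.det = g.1.det * h.1.det := by simp
  have e00 : (g * h) 0 0 = g 0 0 * h 0 0 + g 0 1 * h 1 0 := by
    simp [Matrix.mul_apply, Fin.sum_univ_two]
  have e01 : (g * h) 0 1 = g 0 0 * h 0 1 + g 0 1 * h 1 1 := by
    simp [Matrix.mul_apply, Fin.sum_univ_two]
  have e10 : (g * h) 1 0 = g 1 0 * h 0 0 + g 1 1 * h 1 0 := by
    simp [Matrix.mul_apply, Fin.sum_univ_two]
  have e11 : (g * h) 1 1 = g 1 0 * h 0 1 + g 1 1 * h 1 1 := by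
    simp [Matrix.mul_apply, Fin.sum_univ_two]
  have hD2 := Matrix.det_fin_two g.1
  have hE2 := Matrix.det_fin_two h.1
  by_cases hg : g 1 0 = 0
  · rw [hg] at hD2 e10
    have ga : g 0 0 ≠ 0 := by rintro h0; apply hD; rw [hD2, h0]; ring
    have gd : g 1 1 ≠ 0 := by rintro h0; apply hD; rw [hD2, h0]; ring
    by_cases hh : h 1 0 = 0
    · rw [hh] at hE2 e10
      have ha : h 0 0 ≠ 0 := by rintro h0; apply hE; rw [hE2, h0]; ring
      have hd : h 1 1 ≠ 0 := by rintro h0; apply hE; rw [hE2, h0]; ring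
      rw [act_of_eq_zero θ (by rw [e10]; ring), act_of_eq_zero θ hg, act_of_eq_zero θ hh,
        borel_mul ga gd ha hd, e00, e01, e11, hg, hh]
      simp
    · have h10 : (g * h) 1 0 ≠ 0 := by rw [e10]; simpa using ⟨gd, hh⟩
      have hE' : -(h.1.det / h 1 0) ≠ 0 := by simpa using ⟨hE, hh⟩
      rw [act_of_ne_zero θ h10, act_of_eq_zero θ hg, act_of_ne_zero θ hh, ← mul_assoc,
        ← mul_assoc, borel_mul ga gd one_ne_zero one_ne_zero,
        sandwich θ (by simpa using ga) (by simpa using gd) (by simpa using hh)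
          hE']
      refine triple_congr ?_ ?_
      · refine borel_congr one_ne_zero one_ne_zero one_ne_zero one_ne_zero rfl ?_
        rw [e00, e10]
        field_simp
        ring
      · have h1 : -((g * h).1.det / (g * h) 1 0) ≠ 0 := by
          rw [hDE]
          exact neg_ne_zero.2 (div_ne_zero (mul_ne_zero hD hE) h10)
        apply borel_congr (by simpa using h10) h1
        · exact mul_ne_zero (by simpa using gd) (neg_ne_zero.2 hh)
        · exact mul_ne_zero (by simpa using ga) hE'
        · rw [hDE, e10, hD2]
          field_simp
          ring
        · rw [hDE, e10, e11, hD2, hg]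
          field_simp
          ring
  · have gD : -(g.1.det / g 1 0) ≠ 0 := by simpa using ⟨hD, hg⟩
    by_cases hh : h 1 0 = 0
    · rw [hh] at hE2 e10
      have ha : h 0 0 ≠ 0 := by rintro h0; apply hE; rw [hE2, h0]; ring
      have hd : h 1 1 ≠ 0 := by rintro h0; apply hE; rw [hE2, h0]; ring
      have h10 : (g * h) 1 0 ≠ 0 := by rw [e10]; simpa using ⟨hg, ha⟩
      rw [act_of_ne_zero θ h10, act_of_ne_zero θ hg, act_of_eq_zero θ hh,
        mul_assoc _ _ (borel K (h 0 0) _ _),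
        borel_mul (by simpa using hg) gD ha hd]
      refine triple_congr ?_ ?_
      · refine borel_congr one_ne_zero one_ne_zero one_ne_zero one_ne_zero rfl ?_
        rw [e00, e10, hh]
        field_simp
        ring
      · have h1 : -((g * h).1.det / (g * h) 1 0) ≠ 0 := by
          rw [hDE]
          exact neg_ne_zero.2 (div_ne_zero (mul_ne_zero hD hE) h10)
        apply borel_congr (by simpa using h10) h1
        · simpa using ⟨hg, ha⟩
        · exact mul_ne_zero gD hd
        · rw [hDE, e10, hE2]
          field_simp
          ring
        · rw [hDE, e10, e11, hE2]
          field_simp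
          ring
    · have hE' : -(h.1.det / h 1 0) ≠ 0 := by simpa using ⟨hE, hh⟩
      set x : ZMod p := (g * h) 1 0 / (g 1 0 * h 1 0) with hx
      have key : act θ g * act θ h = borel K 1 (g 0 0 / g 1 0) 1 *
          (wAct θ * borel K 1 (g 1 0 ^ 2 / g.1.det * x) 1 * wAct θ) *
          (borel K 1 0 (g 1 0 ^ 2 / g.1.det) *
            borel K (-h 1 0) (-h 1 1) (-(h.1.det / h 1 0))) := by
        have hk : g 1 0 ^ 2 / g.1.det ≠ 0 := div_ne_zero (pow_ne_zero 2 hg) hD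
        have h1 : borel K (-g 1 0) (-g 1 1) (-(g.1.det / g 1 0)) * borel K 1 (h 0 0 / h 1 0) 1
            = borel K 1 (g 1 0 ^ 2 / g.1.det * x) 1 * borel K (g 1 0 ^ 2 / g.1.det) 0 1 := by
          rw [borel_mul (by simpa using hg) gD one_ne_zero one_ne_zero,
            borel_mul one_ne_zero one_ne_zero hk one_ne_zero]
          apply borel_congr (by simpa using hg) (by simpa using gD) (by simpa using hk) (by simp)
          · field_simp
          · rw [hx, e10]
            field_simp
            ring
        rw [act_of_ne_zero θ hg, act_of_ne_zero θ hh]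
        calc _ = borel K 1 (g 0 0 / g 1 0) 1 * wAct θ *
              (borel K (-g 1 0) (-g 1 1) (-(g.1.det / g 1 0)) * borel K 1 (h 0 0 / h 1 0) 1) *
              wAct θ * borel K (-h 1 0) (-h 1 1) (-(h.1.det / h 1 0)) := by
                simp only [mul_assoc]
          _ = borel K 1 (g 0 0 / g 1 0) 1 * wAct θ * borel K 1 (g 1 0 ^ 2 / g.1.det * x) 1 *
              (borel K (g 1 0 ^ 2 / g.1.det) 0 1 *
              wAct θ) * borel K (-h 1 0) (-h 1 1) (-(h.1.det / h 1 0)) := by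
                rw [h1]
                simp only [mul_assoc]
          _ = _ := by
                have h2 : borel K (g 1 0 ^ 2 / g.1.det) 0 1 * wAct θ
                    = wAct θ * borel K 1 0 (g 1 0 ^ 2 / g.1.det) := by
                  have h3 := sandwich θ (K := K) (b := 0) (b' := 0) hk one_ne_zero
                    (one_ne_zero (α := ZMod p)) one_ne_zero
                  simpa [borel_one] using h3
                rw [h2]
                simp only [mul_assoc]
      have hk : g 1 0 ^ 2 / g.1.det ≠ 0 := div_ne_zero (pow_ne_zero 2 hg) hD
      rw [key, borel_mul one_ne_zero hk (by simpa using hh) hE']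
      by_cases h10 : (g * h) 1 0 = 0
      · have hx0 : x = 0 := by rw [hx, h10, zero_div]
        rw [hx0, mul_zero, borel_one, mul_one, w_mul_w hu θ hθ, mul_one,
          borel_mul one_ne_zero one_ne_zero (by simpa using hh) (mul_ne_zero hk hE'),
          act_of_eq_zero θ h10]
        have h5 : (g * h) 0 0 * (g * h) 1 1 ≠ 0 := by
          have := Matrix.det_fin_two (g * h).1
          rw [hDE, h10, mul_zero, sub_zero] at this
          rw [← this]
          exact mul_ne_zero hD hE
        have h6 : h 0 0 = -(g 1 1 * h 1 0) / g 1 0 := by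
          rw [e10] at h10
          field_simp
          linear_combination h10
        apply borel_congr (left_ne_zero_of_mul h5) (right_ne_zero_of_mul h5)
          (by simpa using hh) (by simpa using mul_ne_zero hk hE')
        · have h7 := right_ne_zero_of_mul h5
          rw [div_eq_div_iff h7 (by simpa using mul_ne_zero hk hE'), e00, e11, h6]
          field_simp
          rw [hE2, h6, hD2]
          field_simp
          ring
        · have h7 := right_ne_zero_of_mul h5
          rw [div_eq_div_iff h7 (by simpa using mul_ne_zero hk hE'), e01, e11]
          field_simp
          rw [hE2, h6, hD2]
          field_simp
          ring
      · have hx0 : x ≠ 0 := div_ne_zero h10 (mul_ne_zero hg hh)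
        set y : ZMod p := g 1 0 ^ 2 / g.1.det * x with hy
        have hy0 : y ≠ 0 := mul_ne_zero hk hx0
        rw [w_borel_w hu θ hθ hy0, act_of_ne_zero θ h10]
        have h5 : ∀ X Y Z P Q : Module.End K (Model p K), X * (Y * Z * P) * Q
            = (X * Y) * Z * (P * Q) := fun X Y Z P Q => by simp only [mul_assoc]
        rw [h5, borel_mul one_ne_zero one_ne_zero one_ne_zero one_ne_zero,
          borel_mul (pow_ne_zero 2 hy0) one_ne_zero (by simpa using hh) (mul_ne_zero hk hE')]
        have h8 : g 1 0 * h 0 0 + g 1 1 * h 1 0 ≠ 0 := e10 ▸ h10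
        refine triple_congr ?_ ?_
        · refine borel_congr one_ne_zero one_ne_zero (mul_ne_zero one_ne_zero one_ne_zero)
            (mul_ne_zero one_ne_zero one_ne_zero) (by simp) ?_
          rw [hy, hx]
          field_simp
          rw [e00, e10, hD2]
          ring
        · apply borel_congr (by simpa using h10)
            (by rw [hDE]; exact neg_ne_zero.2 (div_ne_zero (mul_ne_zero hD hE) h10))
            (mul_ne_zero (pow_ne_zero 2 hy0) (by simpa using hh))
            (mul_ne_zero one_ne_zero (mul_ne_zero hk hE'))
          · rw [hy, hx, hDE, e10]
            field_simp
          · rw [hy, hx, hDE, e10, e11]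
            field_simp
            rw [hE2]
            ring

/-- The cuspidal representation `V_θ` of `GL₂` of the prime field attached to a character `θ` of
`T'/Z` with `θ ^ 2 ≠ 1`. -/
noncomputable def cuspidalRep [CharZero K] (hu : ¬IsSquare u) (θ : TorusModScalars p u →* Kˣ)
    (hθ : θ ^ 2 ≠ 1) : Representation K (GL (Fin 2) (ZMod p)) (Model p K) where
  toFun := act θ
  map_one' := act_one θ
  map_mul' := act_mul hu θ hθ

/-- The subspace of invariants of a subgroup. -/
noncomputable def invariantsOf {G V : Type*} [Group G] [AddCommGroup V] [Module K V]
    (ρ : Representation K G V) (H : Subgroup G) : Submodule K V :=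
  Representation.invariants (ρ.comp H.subtype)

/-- Upper triangular matrices act through their action on the prime field. -/
theorem cuspidalRep_upper [CharZero K] (hu : ¬IsSquare u) (θ : TorusModScalars p u →* Kˣ)
    (hθ : θ ^ 2 ≠ 1) (g : GL (Fin 2) (ZMod p)) (h : g 1 0 = 0) :
    cuspidalRep hu θ hθ g = borel K (g 0 0) (g 0 1) (g 1 1) :=
  act_of_eq_zero θ h

/-- The matrix `w = (0 1; -1 0)` acts by the prescribed character sum. -/
theorem cuspidalRep_w [CharZero K] (hu : ¬IsSquare u) (θ : TorusModScalars p u →* Kˣ)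
    (hθ : θ ^ 2 ≠ 1) (g : GL (Fin 2) (ZMod p)) (h : g.1 = !![0, 1; -1, 0]) :
    cuspidalRep hu θ hθ g = wAct θ := by
  have h00 : g 0 0 = 0 := by simp [h]
  have h10 : g 1 0 = -1 := by simp [h]
  have h11 : g 1 1 = 0 := by simp [h]
  have hd : g.1.det = 1 := by rw [h, Matrix.det_fin_two_of]; ring
  have h1 : act θ g = wAct θ := by
    rw [act_of_ne_zero θ (by rw [h10]; simp), h00, h10, h11, hd]
    simp [borel_one]
  exact h1

/-- The element
`p e_r - ∑_m ∑_y θ(y) e_{(m + r) N(y) / (m ^ 2 - u) + Tr(y) + m}` of the model. -/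
noncomputable def traceVector (θ : TorusModScalars p u →* Kˣ) (r : ZMod p) : Model p K :=
  (p : K) • e K r - ∑ m : ZMod p, ∑ y : nonsplitTorus p u,
    charValue θ y • e K ((m + r) * nm y / (m ^ 2 - u) + tr y + m)

end

end CuspidalModel

namespace CuspidalModel

open scoped MatrixGroups

section

variable {p : ℕ} [Fact p.Prime] {u : ZMod p} {K : Type*} [Field K]

/-! The groups `U` and `T` act by permuting the vectors `e_r`, so averaging settles (a) and the
first half of (b). The sum of all translations kills every `e_r`, because the `e_r` sum to zero, yet
it multiplies a `U`-invariant by `p`. The sum of all dilations sends every `e_r` into the line of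
`e_0`. The normalizer `N` consists of the diagonal and antidiagonal matrices, and the character sum
for `w` gives `w e_0 = -θ(√u) e_0` (`wAct_e_zero`), where `√u` is the matrix `sqrtU`. Its class is
the only element of order two of `T'/Z`, so `θ` is odd exactly when `θ(√u) = -1` (`isOdd_iff`).

For `T'` the argument is by characters. Off the upper triangular matrices, the trace of `g` is `-∑
θ(y)` over the `y` with the norm and trace of `g` (`trace_act`), because an affine map of the line
contributes its number of fixed points minus one. Hence a non-scalar `y` in `T'` has trace `-(θ(y) +
θ(ȳ))`, and a scalar has trace `p - 1`. These traces sum to the order of `T'`, so the averaging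
projection has trace `1` and the invariants form a line (`finrank_invariantsOf_torus`). The group
`N'` is generated by `T'` and the matrix `reflection`, which acts on that line by a scalar; summing
traces over the coset of `reflection` shows that the scalar is `-θ(√u)` (`act_reflection_of_mem`).

The explicit generator is the image of `e_r` under the sum over `T'`, up to the factor `(p - 1) / p`
(`torusSum_e`). It cannot vanish for all `r ≠ 0`: the relation `∑ e_r = 0` would then make the sum
over `T'` zero. -/

theorem natCast_prime_ne_zero (p : ℕ) [Fact p.Prime] (K : Type*) [Field K] [CharZero K] :
    (p : K) ≠ 0 :=
  Nat.cast_ne_zero.2 (Fact.out : p.Prime).ne_zero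

/-! ### Traces of endomorphisms of the model -/

/-- The section of the projection onto the model whose values are the functions of mean zero. -/
noncomputable def meanZeroLift (p : ℕ) [Fact p.Prime] (K : Type*) [Field K] [CharZero K] :
    Model p K →ₗ[K] (ZMod p → K) :=
  (constants p K).liftQ
    { toFun := fun φ x => φ x - (p : K)⁻¹ * ∑ y, φ y
      map_add' := fun φ ψ => by
        funext x
        simp only [Pi.add_apply, Finset.sum_add_distrib]
        ring
      map_smul' := fun c φ => by
        funext x
        simp only [Pi.smul_apply, smul_eq_mul, RingHom.id_apply, ← Finset.mul_sum]
        ring } <| by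
    rw [constants, Submodule.span_le]
    rintro _ rfl
    have := natCast_prime_ne_zero p K
    simp only [SetLike.mem_coe, LinearMap.mem_ker]
    funext x
    simp [ZMod.card, this]

theorem meanZeroLift_e [CharZero K] (s r : ZMod p) :
    meanZeroLift p K (e K s) r = (if r = s then 1 else 0) - (p : K)⁻¹ := by
  rw [e, Submodule.mkQ_apply, meanZeroLift, Submodule.liftQ_apply]
  simp [Pi.single_apply]

theorem mkQ_meanZeroLift [CharZero K] (v : Model p K) :
    (constants p K).mkQ (meanZeroLift p K v) = v := by
  obtain ⟨φ, rfl⟩ := (constants p K).mkQ_surjective v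
  rw [← sub_eq_zero, ← map_sub, Submodule.mkQ_apply, Submodule.Quotient.mk_eq_zero]
  refine Submodule.mem_span_singleton.2 ⟨-((p : K)⁻¹ * ∑ y, φ y), ?_⟩
  funext x
  simp [meanZeroLift]

/-- The model is a retract of the space of functions, so cyclicity of the trace moves the
computation to functions, where the indicator functions form a basis and the diagonal entries can be
read off. -/
theorem trace_eq_sum [CharZero K] (f : Module.End K (Model p K)) :
    LinearMap.trace K _ f = ∑ r, meanZeroLift p K (f (e K r)) r := by
  have h : f = (f ∘ₗ (constants p K).mkQ) ∘ₗ meanZeroLift p K :=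
    LinearMap.ext fun v => by simp only [LinearMap.comp_apply, mkQ_meanZeroLift]
  conv_lhs => rw [h]
  rw [LinearMap.trace_comp_comm', LinearMap.trace_eq_matrix_trace K (Pi.basisFun K (ZMod p)),
    Matrix.trace]
  refine Finset.sum_congr rfl fun r _ => ?_
  rw [Matrix.diag_apply, LinearMap.toMatrix_apply]
  simp [e]

theorem e_ne_zero [CharZero K] (r : ZMod p) : e K r ≠ 0 := by
  intro h
  have h1 := meanZeroLift_e (K := K) r r
  rw [h, map_zero, Pi.zero_apply, if_pos rfl, eq_comm, sub_eq_zero, eq_comm, inv_eq_one] at h1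
  exact (Fact.out : p.Prime).one_lt.ne' (by exact_mod_cast h1)

theorem span_range_e : Submodule.span K (Set.range (e (p := p) K)) = ⊤ := by
  rw [eq_top_iff, ← (constants p K).range_mkQ, LinearMap.range_eq_map,
    ← (Pi.basisFun K (ZMod p)).span_eq, Submodule.map_span, ← Set.range_comp]
  refine Submodule.span_mono ?_
  rintro _ ⟨r, rfl⟩
  exact ⟨r, by simp [e]⟩

/-- This is the permutation trace of an affine map: its number of fixed points minus one, the one
being the share of the constants. A map with `k ≠ 1` has exactly one fixed point. -/
theorem sum_meanZeroLift_affine [CharZero K] {k : ZMod p} (c : ZMod p) :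
    ∑ r, meanZeroLift p K (e K (k * r + c)) r
      = if k = 1 then (if c = 0 then (p : K) else 0) - 1 else 0 := by
  have hp0 := natCast_prime_ne_zero p K
  simp only [meanZeroLift_e, Finset.sum_sub_distrib, Finset.sum_const, Finset.card_univ,
    ZMod.card, nsmul_eq_mul, mul_inv_cancel₀ hp0]
  split_ifs with h1 h2
  · simp [h1, h2, ZMod.card]
  · simp [h1, h2]
  · have h3 : 1 - k ≠ 0 := sub_ne_zero.2 (Ne.symm h1)
    have h4 : ∀ r : ZMod p, r = k * r + c ↔ r = c / (1 - k) := fun r => by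
      rw [eq_div_iff h3]
      constructor <;> intro h <;> linear_combination h
    simp [h4]

/-! ### The character of the representation -/

/-- Scalar form of `sum_norm`, which says that `θ` is nontrivial on elements of norm one; it is
recovered by using multiples of the nonzero vector `e_0` as values. -/
theorem sum_charValue_nm [CharZero K] (θ : TorusModScalars p u →* Kˣ) (hθ : θ ^ 2 ≠ 1)
    (f : ZMod p → K) : ∑ y : nonsplitTorus p u, charValue θ y * f (nm y) = 0 := by
  have h := sum_norm θ hθ (fun n => f n • e K (0 : ZMod p))
  simp only [smul_smul, ← Finset.sum_smul] at h
  exact (smul_eq_zero.1 h).resolve_right (e_ne_zero 0)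

theorem sum_charValue [CharZero K] (θ : TorusModScalars p u →* Kˣ) (hθ : θ ^ 2 ≠ 1) :
    ∑ y : nonsplitTorus p u, charValue θ y = 0 := by
  simpa using sum_charValue_nm θ hθ 1

theorem nm_mkScalar {a : ZMod p} (ha : a ≠ 0) : nm (mkScalar (u := u) a ha) = a ^ 2 := by
  rw [nm_eq, mkScalar, mkT_zero, mkT_one]
  ring

theorem tr_mul_mkScalar (y : nonsplitTorus p u) {a : ZMod p} (ha : a ≠ 0) :
    tr (y * mkScalar a ha) = a * tr y := by
  rw [tr_eq, tr_eq, (coord_mul y _).1, mkScalar, mkT_zero, mkT_one]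
  ring

theorem act_e (θ : TorusModScalars p u →* Kˣ) {g : GL (Fin 2) (ZMod p)} (hg : g 1 0 ≠ 0)
    (r : ZMod p) :
    act θ g (e K r) = (-(1 / (p : K))) • ∑ y : nonsplitTorus p u, charValue θ y •
      e K (nm y / g.1.det * r + (nm y / g.1.det * g 1 1 + g 0 0 - tr y) / g 1 0) := by
  have hD : g.1.det ≠ 0 := (Matrix.isUnits_det_units g).ne_zero
  rw [act_of_ne_zero θ hg, Module.End.mul_apply, Module.End.mul_apply,
    borel_e (neg_ne_zero.2 hg) (neg_ne_zero.2 (div_ne_zero hD hg)), wAct_e]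
  simp only [map_smul, map_sum, borel_e one_ne_zero one_ne_zero]
  congr 1
  -- Rescaling `y` by the scalar `-1/c`, on which `θ` is trivial, makes the slope `N(y) / det g`, so
  -- that slope one singles out the norm `det g`.
  have hc : -(g 1 0)⁻¹ ≠ 0 := neg_ne_zero.2 (inv_ne_zero hg)
  rw [← Equiv.sum_comp (Equiv.mulRight (mkScalar _ hc))]
  refine Finset.sum_congr rfl fun y _ => ?_
  rw [Equiv.coe_mulRight, charValue_mul, charValue_mkScalar, mul_one, nm_mul, nm_mkScalar,
    tr_mul_mkScalar]
  congr 2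
  field_simp
  ring

/-- The character of the cuspidal representation at a matrix that is not upper triangular. -/
theorem trace_act [CharZero K] (θ : TorusModScalars p u →* Kˣ) (hθ : θ ^ 2 ≠ 1)
    {g : GL (Fin 2) (ZMod p)} (hg : g 1 0 ≠ 0) :
    LinearMap.trace K _ (act θ g) = -∑ y : nonsplitTorus p u,
      if nm y = g.1.det ∧ tr y = g 0 0 + g 1 1 then charValue θ y else 0 := by
  have hD : g.1.det ≠ 0 := (Matrix.isUnits_det_units g).ne_zero
  have hp0 := natCast_prime_ne_zero p K
  rw [trace_eq_sum]
  simp only [act_e θ hg, map_smul, map_sum, Finset.sum_apply, Pi.smul_apply, smul_eq_mul]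
  rw [← Finset.mul_sum, Finset.sum_comm]
  simp only [← Finset.mul_sum, sum_meanZeroLift_affine, div_eq_one_iff_eq hD]
  have h := sum_charValue_nm θ hθ (fun n => if n = g.1.det then (1 : K) else 0)
  -- Only slope one contributes. The translation part then vanishes exactly when the traces agree,
  -- and the leftover terms `-1` depend on the norm alone, so they cancel against `θ` by `h`.
  have h2 : ∀ y : nonsplitTorus p u, (charValue θ y * if nm y = g.1.det then
      (if (nm y / g.1.det * g 1 1 + g 0 0 - tr y) / g 1 0 = 0 then (p : K) else 0) - 1 else 0)
      = p * (if nm y = g.1.det ∧ tr y = g 0 0 + g 1 1 then charValue θ y else 0)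
        - charValue θ y * if nm y = g.1.det then (1 : K) else 0 := by
    intro y
    by_cases h1 : nm y = g.1.det
    · have h3 : (nm y / g.1.det * g 1 1 + g 0 0 - tr y) / g 1 0 = 0
          ↔ tr y = g 0 0 + g 1 1 := by
        rw [div_eq_zero_iff, or_iff_left hg, h1, div_self hD, one_mul, sub_eq_zero, add_comm,
          eq_comm]
      simp only [h3]
      simp only [h1, true_and, if_true]
      split_ifs <;> ring
    · simp [h1]
  rw [Finset.sum_congr rfl fun y _ => h2 y, Finset.sum_sub_distrib, h, ← Finset.mul_sum]
  field_simp
  ring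

theorem trace_borel_reflection [CharZero K] (hu : ¬IsSquare u) {a d : ZMod p} (ha : a ≠ 0)
    (had : d = -a) : LinearMap.trace K _ (borel K a 0 d) = 0 := by
  have h2 := two_ne_zero_of hu
  have hd : d ≠ 0 := had ▸ neg_ne_zero.2 ha
  have h : a / d ≠ 1 := by
    rw [Ne, div_eq_one_iff_eq hd, had]
    intro h
    exact mul_ne_zero h2 ha (by linear_combination h)
  rw [trace_eq_sum]
  simp only [borel_e ha hd, add_div, mul_div_right_comm]
  rw [sum_meanZeroLift_affine, if_neg h]

/-! ### Elements of the non-split torus -/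

/-- The conjugate `(a -bu; -b a)` of an element `(a bu; b a)` of `T'`. -/
def conjT (y : nonsplitTorus p u) : nonsplitTorus p u :=
  mkT (y.1 0 0) (-y.1 1 0) (by rw [neg_sq, ← nm_eq]; exact nm_ne_zero y)

theorem conjT_zero (y : nonsplitTorus p u) : (conjT y).1 0 0 = y.1 0 0 := mkT_zero _ _ _

theorem conjT_one (y : nonsplitTorus p u) : (conjT y).1 1 0 = -y.1 1 0 := mkT_one _ _ _

theorem conjT_involutive : Function.Involutive (conjT (u := u)) := fun y =>
  torus_ext (by rw [conjT_zero, conjT_zero]) (by rw [conjT_one, conjT_one, neg_neg])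

/-- Norm and trace are the coefficients of the characteristic polynomial, and conjugation exchanges
its two roots in the quadratic field. -/
theorem nm_tr_eq_iff (hu : ¬IsSquare u) (y z : nonsplitTorus p u) :
    nm z = nm y ∧ tr z = tr y ↔ z = y ∨ z = conjT y := by
  have h2 := two_ne_zero_of hu
  have hu0 : u ≠ 0 := by
    rintro rfl
    exact hu IsSquare.zero
  constructor
  · rintro ⟨hn, ht⟩
    rw [tr_eq, tr_eq] at ht
    have h0 := mul_left_cancel₀ h2 ht
    rw [nm_eq, nm_eq, h0] at hn
    have h1 : z.1 1 0 ^ 2 = y.1 1 0 ^ 2 := mul_left_cancel₀ hu0 (by linear_combination -hn)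
    rcases sq_eq_sq_iff_eq_or_eq_neg.1 h1 with h | h
    · exact Or.inl (torus_ext h0 h)
    · exact Or.inr (torus_ext (by rw [conjT_zero, h0]) (by rw [conjT_one, h]))
  · rintro (rfl | rfl)
    · exact ⟨rfl, rfl⟩
    · rw [nm_eq, nm_eq, tr_eq, tr_eq, conjT_zero, conjT_one, neg_sq]
      exact ⟨rfl, rfl⟩

theorem charValue_conjT_of_scalar (θ : TorusModScalars p u →* Kˣ) {y : nonsplitTorus p u}
    (hy : y.1 1 0 = 0) : charValue θ (conjT y) = 1 :=
  charValue_of_scalar θ _ (by rw [conjT_one, hy, neg_zero])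

theorem act_scalar (θ : TorusModScalars p u →* Kˣ) {y : nonsplitTorus p u}
    (hy : y.1 1 0 = 0) : act θ y.1 = 1 := by
  have h0 := nm_ne_zero y
  rw [nm_eq, hy] at h0
  have ha : y.1 0 0 ≠ 0 := by
    intro h
    simp [h] at h0
  obtain ⟨h1, h2⟩ := y.2
  rw [act_of_eq_zero θ hy, h1, h2, hy, zero_mul,
    borel_congr ha ha one_ne_zero one_ne_zero (by rw [div_self ha, div_one])
      (b' := 0) (by simp), borel_one]

theorem trace_one [CharZero K] : LinearMap.trace K _ (1 : Module.End K (Model p K)) = p - 1 := by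
  rw [trace_eq_sum]
  have h := sum_meanZeroLift_affine (p := p) (K := K) (k := 1) 0
  simpa using h

/-- The correction term is there because a scalar has trace `p - 1 = -2 + (p + 1)`. This uniform
shape makes the sum over `T'` immediate. -/
theorem trace_act_torus [CharZero K] (hu : ¬IsSquare u) (θ : TorusModScalars p u →* Kˣ)
    (hθ : θ ^ 2 ≠ 1) (y : nonsplitTorus p u) :
    LinearMap.trace K _ (act θ y.1) = -(charValue θ y + charValue θ (conjT y))
      + if y.1 1 0 = 0 then (p : K) + 1 else 0 := by
  classical
  by_cases hy : y.1 1 0 = 0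
  · rw [act_scalar θ hy, trace_one, charValue_of_scalar θ y hy, charValue_conjT_of_scalar θ hy,
      if_pos hy]
    ring
  · have hne : y ≠ conjT y := fun h => by
      have h1 := congrArg (fun t : nonsplitTorus p u => t.1 1 0) h
      simp only [conjT_one] at h1
      exact mul_ne_zero (two_ne_zero_of hu) hy (by linear_combination h1)
    rw [trace_act θ hθ hy, if_neg hy, add_zero]
    congr 1
    have h1 : ∀ z : nonsplitTorus p u, (nm z = y.1.1.det ∧ tr z = y.1 0 0 + y.1 1 1)
        ↔ z = y ∨ z = conjT y := fun z => by
      rw [← nm_tr_eq_iff hu, ← Matrix.trace_fin_two]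
      rfl
    simp only [h1]
    rw [← Finset.sum_filter, Finset.filter_or, Finset.sum_union]
    · simp [Finset.filter_eq']
    · simp [Finset.filter_eq', hne]

/-! ### Counting in the non-split torus -/

theorem sum_scalar (hu : ¬IsSquare u) (c : K) :
    ∑ y : nonsplitTorus p u, (if y.1 1 0 = 0 then c else 0) = (p - 1) * c := by
  have h := sum_torus hu (fun _ b => if b = 0 then c else (0 : K))
  simp only [Finset.sum_ite_eq', Finset.mem_univ, if_true, Finset.sum_const, Finset.card_univ,
    ZMod.card, nsmul_eq_mul] at h
  linear_combination -h

theorem sum_zero_entry (hu : ¬IsSquare u) (c : K) :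
    ∑ y : nonsplitTorus p u, (if y.1 0 0 = 0 then c else 0) = (p - 1) * c := by
  have h := sum_torus hu (fun a _ => if a = 0 then c else (0 : K))
  simp only [Finset.sum_const, Finset.card_univ, ZMod.card, nsmul_eq_mul, ← Finset.mul_sum,
    Finset.sum_ite_eq', Finset.mem_univ, if_true] at h
  linear_combination -h

theorem sum_e_dilation (r : ZMod p) :
    ∑ a ∈ ({0}ᶜ : Finset (ZMod p)), e K (a * r)
      = ((if r = 0 then (p : K) else 0) - 1) • e K (0 : ZMod p) := by
  split_ifs with hr
  · simp only [hr, mul_zero, Finset.sum_const, Finset.card_compl, Finset.card_singleton,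
      ZMod.card]
    rw [← Nat.cast_smul_eq_nsmul K, Nat.cast_sub (Fact.out : p.Prime).one_lt.le, Nat.cast_one]
  · have h := sum_e_affine (K := K) hr 0
    rw [Fintype.sum_eq_add_sum_compl (0 : ZMod p)] at h
    simp only [add_zero, mul_comm r, zero_mul] at h
    rw [zero_sub, neg_one_smul]
    exact eq_neg_of_add_eq_zero_right h

theorem card_torus_cast (K : Type*) [Field K] (hu : ¬IsSquare u) :
    (Fintype.card (nonsplitTorus p u) : K) = (p : K) ^ 2 - 1 := by
  have := congrArg (Int.cast (R := K)) (card_torus hu)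
  push_cast at this
  exact this

/-- Both character sums vanish, and the `p - 1` scalars contribute `p + 1` each, which gives `p ^ 2
- 1`. -/
theorem sum_trace_act_torus [CharZero K] (hu : ¬IsSquare u) (θ : TorusModScalars p u →* Kˣ)
    (hθ : θ ^ 2 ≠ 1) :
    ∑ y : nonsplitTorus p u, LinearMap.trace K _ (act θ y.1)
      = Fintype.card (nonsplitTorus p u) := by
  simp only [trace_act_torus hu θ hθ, Finset.sum_add_distrib, Finset.sum_neg_distrib,
    sum_scalar hu]
  have h := Equiv.sum_comp (conjT_involutive (u := u)).toPerm (charValue θ)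
  simp only [Function.Involutive.coe_toPerm] at h
  rw [h, sum_charValue θ hθ, card_torus_cast K hu]
  ring

/-- The number of elements of given norm. -/
theorem sum_nm_eq [CharZero K] (hu : ¬IsSquare u) {c : ZMod p} (hc : c ≠ 0) :
    ∑ y : nonsplitTorus p u, (if nm y = c then (1 : K) else 0) = p + 1 := by
  have h := sum_e_norm (K := K) hu one_ne_zero 0
  simp only [one_mul, add_zero] at h
  -- The difference of the values at `c` and `0` is insensitive to constants. No norm is `0`, so on
  -- the left only the elements of norm `c` are counted.
  have h1 := congrArg (fun v => meanZeroLift p K v c - meanZeroLift p K v 0) h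
  simp only [map_sum, map_smul, Finset.sum_apply, Pi.smul_apply, smul_eq_mul, meanZeroLift_e,
    ← Finset.sum_sub_distrib, if_true, if_neg hc] at h1
  have h2 : ∀ y : nonsplitTorus p u, (0 : ZMod p) ≠ nm y := fun y => (nm_ne_zero y).symm
  simp only [if_neg (h2 _)] at h1
  simp only [eq_comm (a := c)] at h1
  ring_nf at h1 ⊢
  linear_combination h1

/-! ### The element of order two -/

/-- The element `(0 u; 1 0)` of `T'`, a square root of `u`. -/
def sqrtU (hu : ¬IsSquare u) : nonsplitTorus p u :=
  mkT 0 1 (form_ne_zero hu (Or.inr one_ne_zero))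

theorem sqrtU_zero (hu : ¬IsSquare u) : (sqrtU hu).1 0 0 = 0 := mkT_zero _ _ _

theorem sqrtU_one (hu : ¬IsSquare u) : (sqrtU hu).1 1 0 = 1 := mkT_one _ _ _

theorem charValue_sqrtU_sq (hu : ¬IsSquare u) (θ : TorusModScalars p u →* Kˣ) :
    charValue θ (sqrtU hu) ^ 2 = 1 := by
  rw [sq, ← charValue_mul]
  apply charValue_of_scalar
  rw [(coord_mul _ _).2, sqrtU_zero]
  ring

theorem exists_scalar_mul {y z : nonsplitTorus p u} {a : ZMod p} (ha : a ≠ 0)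
    (h0 : y.1 0 0 = z.1 0 0 * a) (h1 : y.1 1 0 = z.1 1 0 * a) : y = z * mkScalar a ha := by
  refine torus_ext ?_ ?_
  · rw [(coord_mul _ _).1, mkScalar, mkT_zero, mkT_one, h0]
    ring
  · rw [(coord_mul _ _).2, mkScalar, mkT_zero, mkT_one, h1]
    ring

theorem eq_sqrtU_mul (hu : ¬IsSquare u) {y : nonsplitTorus p u} (hy : y.1 0 0 = 0) :
    ∃ (a : ZMod p) (ha : a ≠ 0), y = sqrtU hu * mkScalar a ha := by
  have ha : y.1 1 0 ≠ 0 := by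
    intro h
    apply nm_ne_zero y
    rw [nm_eq, hy, h]
    ring
  refine ⟨_, ha, exists_scalar_mul ha ?_ ?_⟩
  · rw [hy, sqrtU_zero, zero_mul]
  · rw [sqrtU_one, one_mul]

theorem charValue_of_zero (hu : ¬IsSquare u) (θ : TorusModScalars p u →* Kˣ)
    {y : nonsplitTorus p u} (hy : y.1 0 0 = 0) : charValue θ y = charValue θ (sqrtU hu) := by
  obtain ⟨a, ha, rfl⟩ := eq_sqrtU_mul hu hy
  rw [charValue_mul, charValue_mkScalar, mul_one]

theorem mk_eq_one_iff {y : nonsplitTorus p u} :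
    (QuotientGroup.mk y : TorusModScalars p u) = 1 ↔ y.1 1 0 = 0 := by
  rw [QuotientGroup.eq_one_iff, Subgroup.mem_subgroupOf, scalars, MonoidHom.mem_range]
  constructor
  · rintro ⟨a, ha⟩
    rw [← ha]
    simp [Matrix.GeneralLinearGroup.scalar]
  · intro hy
    have h0 := nm_ne_zero y
    rw [nm_eq, hy] at h0
    have h1 : y.1 0 0 ≠ 0 := by
      intro h
      simp [h] at h0
    refine ⟨Units.mk0 _ h1, Matrix.GeneralLinearGroup.ext fun i j => ?_⟩
    obtain ⟨a1, a2⟩ := y.2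
    fin_cases i <;> fin_cases j <;> simp_all [Matrix.GeneralLinearGroup.scalar]

/-- The lower left entry of `y ^ 2` is `2ab`, so a non-scalar `y` has scalar square exactly when `a
= 0`. -/
theorem orderOf_mk_eq_two_iff (hu : ¬IsSquare u) {y : nonsplitTorus p u} :
    orderOf (QuotientGroup.mk y : TorusModScalars p u) = 2 ↔ y.1 0 0 = 0 := by
  rw [orderOf_eq_prime_iff, ← QuotientGroup.mk_pow, mk_eq_one_iff, Ne, mk_eq_one_iff, sq,
    (coord_mul y y).2]
  constructor
  · rintro ⟨h, h1⟩
    refine (mul_eq_zero.1 ?_).resolve_right h1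
    refine (mul_eq_zero.1 ?_).resolve_left (two_ne_zero_of hu)
    linear_combination h
  · intro h
    refine ⟨by rw [h]; ring, fun h1 => nm_ne_zero y ?_⟩
    rw [nm_eq, h, h1]
    ring

theorem isOdd_iff [CharZero K] (hu : ¬IsSquare u) (θ : TorusModScalars p u →* Kˣ) :
    IsOdd θ ↔ charValue θ (sqrtU hu) = -1 := by
  constructor
  · intro h
    refine (mul_self_eq_one_iff.1 (by rw [← sq, charValue_sqrtU_sq])).resolve_left fun h1 => ?_
    exact h _ ((orderOf_mk_eq_two_iff hu).2 (sqrtU_zero hu)) (Units.ext h1)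
  · intro h t ht h1
    obtain ⟨y, rfl⟩ := QuotientGroup.mk_surjective t
    have h2 := charValue_of_zero hu θ ((orderOf_mk_eq_two_iff hu).1 ht)
    rw [charValue, h1, h] at h2
    norm_num at h2

/-! ### The normalizer of the non-split torus -/

theorem mul_entry (g h : GL (Fin 2) (ZMod p)) (i j : Fin 2) :
    (g * h) i j = g i 0 * h 0 j + g i 1 * h 1 j := by
  simp [Matrix.mul_apply, Fin.sum_univ_two]

/-- The diagonal matrix with entries `1` and `-1`. -/
noncomputable def reflection (p : ℕ) [Fact p.Prime] : GL (Fin 2) (ZMod p) :=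
  Matrix.GeneralLinearGroup.mkOfDetNeZero !![1, 0; 0, -1]
    (by rw [Matrix.det_fin_two_of]; simp)

theorem reflection_entries : reflection p 0 0 = 1 ∧ reflection p 0 1 = 0 ∧
    reflection p 1 0 = 0 ∧ reflection p 1 1 = -1 := by
  simp [reflection, Matrix.GeneralLinearGroup.mkOfDetNeZero]

theorem reflection_mul_self : reflection p * reflection p = 1 := by
  obtain ⟨h1, h2, h3, h4⟩ := reflection_entries (p := p)
  refine Matrix.GeneralLinearGroup.ext fun i j => ?_
  rw [mul_entry]
  fin_cases i <;> fin_cases j <;> simp [h1, h2, h3, h4]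

theorem reflection_mul_mem (y : nonsplitTorus p u) :
    reflection p * y.1 = (conjT y).1 * reflection p := by
  obtain ⟨h1, h2, h3, h4⟩ := reflection_entries (p := p)
  obtain ⟨a1, a2⟩ := y.2
  obtain ⟨b1, b2⟩ := (conjT y).2
  rw [conjT_zero] at b1
  rw [conjT_one] at b2
  refine Matrix.GeneralLinearGroup.ext fun i j => ?_
  rw [mul_entry, mul_entry]
  fin_cases i <;> fin_cases j <;> simp [h1, h2, h3, h4, a1, a2, b1, b2, conjT_zero, conjT_one]

theorem reflection_conj (y : nonsplitTorus p u) :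
    reflection p * y.1 * (reflection p)⁻¹ = (conjT y).1 := by
  rw [reflection_mul_mem, mul_inv_cancel_right]

theorem reflection_inv : (reflection p)⁻¹ = reflection p :=
  inv_eq_of_mul_eq_one_right reflection_mul_self

theorem reflection_mem_normalizer (u : ZMod p) :
    reflection p ∈ Subgroup.normalizer (nonsplitTorus p u : Set (GL (Fin 2) (ZMod p))) := by
  refine Subgroup.mem_normalizer_iff.2 fun h => ⟨fun hh => ?_, fun hh => ?_⟩
  · rw [reflection_conj ⟨h, hh⟩]
    exact (conjT _).2
  · have h1 := reflection_conj ⟨_, hh⟩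
    have h2 : h = reflection p * (reflection p * h * (reflection p)⁻¹) * (reflection p)⁻¹ := by
      rw [reflection_inv]
      simp only [← mul_assoc, reflection_mul_self, one_mul]
      rw [mul_assoc, reflection_mul_self, mul_one]
    rw [h2, h1]
    exact (conjT _).2

/-- Conjugation by `g` sends `√u` to an element of `T'` with the same norm and trace, hence to `√u`
or its conjugate `-√u`. In the first case `g` commutes with `√u` and lies in `T'`; in the second,
`reflection p * g` does. -/
theorem mem_or_mem_of_mem_normalizer (hu : ¬IsSquare u) {g : GL (Fin 2) (ZMod p)}
    (hg : g ∈ Subgroup.normalizer (nonsplitTorus p u : Set (GL (Fin 2) (ZMod p)))) :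
    g ∈ nonsplitTorus p u ∨ reflection p * g ∈ nonsplitTorus p u := by
  have hu0 : u ≠ 0 := by
    rintro rfl
    exact hu IsSquare.zero
  have ht := (Subgroup.mem_normalizer_iff.1 hg _).1 (sqrtU hu).2
  set t : nonsplitTorus p u := ⟨_, ht⟩ with h_t
  have h1 : t.1 * g = g * (sqrtU hu).1 := by
    rw [h_t]
    exact inv_mul_cancel_right _ _
  have htr : tr t = tr (sqrtU hu) := by
    rw [tr, tr, h_t]
    simp only [Units.val_mul]
    rw [Matrix.trace_mul_comm, ← mul_assoc, ← Units.val_mul, inv_mul_cancel, Units.val_one,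
      one_mul]
  have hnm : nm t = nm (sqrtU hu) := by
    rw [nm, nm, h_t]
    simp only [Units.val_mul, Matrix.det_mul]
    rw [mul_right_comm, ← Matrix.det_mul, ← Units.val_mul, mul_inv_cancel, Units.val_one,
      Matrix.det_one, one_mul]
  obtain ⟨t1, t2⟩ := t.2
  have e00 := congrArg (fun m : GL (Fin 2) (ZMod p) => m 0 0) h1
  have e10 := congrArg (fun m : GL (Fin 2) (ZMod p) => m 1 0) h1
  simp only [mul_entry, t1, t2, sqrtU_zero, sqrtU_one] at e00 e10
  obtain ⟨r1, r2, r3, r4⟩ := reflection_entries (p := p)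
  rcases (nm_tr_eq_iff hu _ _).1 ⟨hnm, htr⟩ with h | h
  · left
    rw [h, sqrtU_zero, sqrtU_one] at e00 e10
    exact ⟨by linear_combination -e10, by linear_combination -e00⟩
  · right
    rw [h, conjT_zero, conjT_one, sqrtU_zero, sqrtU_one] at e00 e10
    constructor
    · rw [mul_entry, mul_entry, r1, r2, r3, r4]
      linear_combination e10
    · rw [mul_entry, mul_entry, r1, r2, r3, r4]
      linear_combination -e00

/-! ### The sum over the non-split torus -/

/-- The sum of the operators of the elements of `T'`. -/
noncomputable def torusSum (θ : TorusModScalars p u →* Kˣ) : Module.End K (Model p K) :=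
  ∑ y : nonsplitTorus p u, act θ y.1

variable [CharZero K]

theorem card_torus_ne_zero (u : ZMod p) (K : Type*) [Field K] [CharZero K] :
    (Fintype.card (nonsplitTorus p u) : K) ≠ 0 :=
  Nat.cast_ne_zero.2 Fintype.card_ne_zero

theorem mem_invariantsOf {hu : ¬IsSquare u} {θ : TorusModScalars p u →* Kˣ} {hθ : θ ^ 2 ≠ 1}
    {H : Subgroup (GL (Fin 2) (ZMod p))} {v : Model p K} :
    v ∈ invariantsOf (cuspidalRep hu θ hθ) H ↔ ∀ g ∈ H, act θ g v = v :=
  ⟨fun h g hg => h ⟨g, hg⟩, fun h g => h g.1 g.2⟩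

theorem torusSum_mem (hu : ¬IsSquare u) (θ : TorusModScalars p u →* Kˣ) (hθ : θ ^ 2 ≠ 1)
    (v : Model p K) :
    torusSum θ v ∈ invariantsOf (cuspidalRep hu θ hθ) (nonsplitTorus p u) := by
  rw [mem_invariantsOf]
  intro g hg
  rw [torusSum, LinearMap.sum_apply, map_sum]
  conv_rhs => rw [← Equiv.sum_comp (Equiv.mulLeft ⟨g, hg⟩)]
  refine Finset.sum_congr rfl fun y _ => ?_
  rw [Equiv.coe_mulLeft, Subgroup.coe_mul, act_mul hu θ hθ, Module.End.mul_apply]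

theorem torusSum_of_mem {hu : ¬IsSquare u} {θ : TorusModScalars p u →* Kˣ} {hθ : θ ^ 2 ≠ 1}
    {v : Model p K} (hv : v ∈ invariantsOf (cuspidalRep hu θ hθ) (nonsplitTorus p u)) :
    torusSum θ v = (Fintype.card (nonsplitTorus p u) : K) • v := by
  rw [mem_invariantsOf] at hv
  rw [torusSum, LinearMap.sum_apply, Finset.sum_congr rfl fun y _ => hv y.1 y.2, Finset.sum_const,
    Finset.card_univ, Nat.cast_smul_eq_nsmul]

/-- The trace of a projection is the dimension of its image. -/
theorem finrank_invariantsOf_torus (hu : ¬IsSquare u) (θ : TorusModScalars p u →* Kˣ)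
    (hθ : θ ^ 2 ≠ 1) :
    Module.finrank K (invariantsOf (cuspidalRep hu θ hθ) (nonsplitTorus p u)) = 1 := by
  have hc := card_torus_ne_zero u K
  have h : LinearMap.IsProj (invariantsOf (cuspidalRep hu θ hθ) (nonsplitTorus p u))
      ((Fintype.card (nonsplitTorus p u) : K)⁻¹ • torusSum θ) :=
    { map_mem := fun v => Submodule.smul_mem _ _ (torusSum_mem hu θ hθ v)
      map_id := fun v hv => by
        rw [LinearMap.smul_apply, torusSum_of_mem hv, smul_smul, inv_mul_cancel₀ hc, one_smul] }
  have h1 := h.trace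
  rw [map_smul, torusSum, map_sum, sum_trace_act_torus hu θ hθ, smul_eq_mul,
    inv_mul_cancel₀ hc] at h1
  exact_mod_cast h1.symm

/-! ### The reflection on the invariant line -/

/-- The product has trace `0` and determinant `-N(t)`, and every `y` of trace zero is a scalar
multiple of `√u`, so `θ(y) = θ(√u)`. -/
theorem trace_act_reflection_mul (hu : ¬IsSquare u) (θ : TorusModScalars p u →* Kˣ)
    (hθ : θ ^ 2 ≠ 1) (t : nonsplitTorus p u) :
    LinearMap.trace K _ (act θ (reflection p * t.1)) = -charValue θ (sqrtU hu) *
      ∑ y : nonsplitTorus p u, if y.1 0 0 = 0 ∧ nm t = -nm y then 1 else 0 := by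
  obtain ⟨r1, r2, r3, r4⟩ := reflection_entries (p := p)
  obtain ⟨t1, t2⟩ := t.2
  have e00 : (reflection p * t.1) 0 0 = t.1 0 0 := by rw [mul_entry, r1, r2]; ring
  have e01 : (reflection p * t.1) 0 1 = t.1 1 0 * u := by rw [mul_entry, r1, r2, t2]; ring
  have e10 : (reflection p * t.1) 1 0 = -t.1 1 0 := by rw [mul_entry, r3, r4]; ring
  have e11 : (reflection p * t.1) 1 1 = -t.1 0 0 := by rw [mul_entry, r3, r4, t1]; ring
  have hdet : (reflection p * t.1).1.det = -nm t := by
    rw [Matrix.det_fin_two, e00, e01, e10, e11, nm_eq]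
    ring
  -- For scalar `t` the product is upper triangular and `trace_act` does not apply. Both sides are
  -- then zero: `N(t) = -N(y)` with `y` of trace zero would make `u` a square.
  by_cases ht : t.1 1 0 = 0
  · have ht0 : t.1 0 0 ≠ 0 := fun h => nm_ne_zero t (by rw [nm_eq, h, ht]; ring)
    rw [act_of_eq_zero θ (by rw [e10, ht, neg_zero]), e00, e01, e11, ht, zero_mul,
      trace_borel_reflection hu ht0 rfl, Finset.sum_eq_zero, mul_zero]
    intro y _
    refine if_neg fun ⟨h0, h1⟩ => ?_
    have h := form_ne_zero hu (a := t.1 0 0) (b := y.1 1 0) (Or.inl ht0)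
    rw [nm_eq, nm_eq, ht, h0] at h1
    exact h (by linear_combination h1)
  · rw [trace_act θ hθ (by rw [e10]; exact neg_ne_zero.2 ht), e00, e11, hdet, neg_mul,
      Finset.mul_sum]
    congr 1
    refine Finset.sum_congr rfl fun y _ => ?_
    have h : (nm y = -nm t ∧ tr y = t.1 0 0 + -t.1 0 0) ↔ (y.1 0 0 = 0 ∧ nm t = -nm y) := by
      rw [add_neg_cancel, tr_eq, mul_eq_zero, or_iff_right (two_ne_zero_of hu), and_comm,
        eq_neg_iff_add_eq_zero, eq_neg_iff_add_eq_zero, add_comm]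
    simp only [h]
    split_ifs with h1
    · rw [charValue_of_zero hu θ h1.1, mul_one]
    · rw [mul_zero]

/-- After exchanging the sums, each of the `p - 1` elements `y` of trace zero is met by the `p + 1`
elements `t` of norm `-N(y)`. -/
theorem trace_reflection_mul_torusSum (hu : ¬IsSquare u) (θ : TorusModScalars p u →* Kˣ)
    (hθ : θ ^ 2 ≠ 1) :
    LinearMap.trace K _ (act θ (reflection p) * torusSum θ)
      = -charValue θ (sqrtU hu) * Fintype.card (nonsplitTorus p u) := by
  rw [torusSum, Finset.mul_sum, map_sum]
  simp only [← act_mul hu θ hθ, trace_act_reflection_mul hu θ hθ]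
  rw [← Finset.mul_sum, Finset.sum_comm]
  congr 1
  have h : ∀ y : nonsplitTorus p u, ∑ t : nonsplitTorus p u,
      (if y.1 0 0 = 0 ∧ nm t = -nm y then (1 : K) else 0)
        = if y.1 0 0 = 0 then (p : K) + 1 else 0 := fun y => by
    by_cases hy : y.1 0 0 = 0
    · simp only [hy, true_and, if_true]
      exact sum_nm_eq hu (neg_ne_zero.2 (nm_ne_zero y))
    · simp [hy]
  rw [Finset.sum_congr rfl fun y _ => h y, sum_zero_entry hu, card_torus_cast K hu]
  ring

theorem act_reflection_of_mem {hu : ¬IsSquare u} {θ : TorusModScalars p u →* Kˣ} {hθ : θ ^ 2 ≠ 1}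
    {v : Model p K} (hv : v ∈ invariantsOf (cuspidalRep hu θ hθ) (nonsplitTorus p u)) :
    act θ (reflection p) v = -charValue θ (sqrtU hu) • v := by
  obtain ⟨v₀, hv₀, hspan⟩ := finrank_eq_one_iff'.1 (finrank_invariantsOf_torus hu θ hθ)
  have hmem : act θ (reflection p) v₀ ∈
      invariantsOf (cuspidalRep hu θ hθ) (nonsplitTorus p u) := by
    rw [mem_invariantsOf]
    intro g hg
    have h1 := reflection_mul_mem (conjT ⟨g, hg⟩)
    rw [conjT_involutive] at h1
    rw [← Module.End.mul_apply, ← act_mul hu θ hθ, ← h1, act_mul hu θ hθ, Module.End.mul_apply,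
      mem_invariantsOf.1 v₀.2 _ (conjT _).2]
  obtain ⟨s, hs⟩ := hspan ⟨_, hmem⟩
  have hs0 : act θ (reflection p) v₀ = s • (v₀ : Model p K) := (congrArg Subtype.val hs).symm
  have hs1 : ∀ w ∈ invariantsOf (cuspidalRep hu θ hθ) (nonsplitTorus p u),
      act θ (reflection p) w = s • w := fun w hw => by
    obtain ⟨c, hc⟩ := hspan ⟨w, hw⟩
    have hc' : w = c • (v₀ : Model p K) := (congrArg Subtype.val hc).symm
    rw [hc', map_smul, hs0, smul_comm]
  -- The image of `torusSum` is invariant, so `reflection` acts on it by `s`; comparing traces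
  -- determines `s`.
  have h2 : act θ (reflection p) * torusSum θ = s • torusSum θ := LinearMap.ext fun w => by
    rw [Module.End.mul_apply, hs1 _ (torusSum_mem hu θ hθ w), LinearMap.smul_apply]
  have h3 := trace_reflection_mul_torusSum hu θ hθ
  rw [h2, map_smul, torusSum, map_sum, sum_trace_act_torus hu θ hθ, smul_eq_mul] at h3
  rw [hs1 v hv, mul_right_cancel₀ (card_torus_ne_zero u K) h3]

/-! ### The explicit generator -/

/-- Modulo scalars, `T'` consists of the identity and the classes of `m + √u` with `m = a / b`, each
hit by `p - 1` matrices. The identity gives `e_r` and the other classes give the sum over `m`. -/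
theorem torusSum_e (hu : ¬IsSquare u) (θ : TorusModScalars p u →* Kˣ) (r : ZMod p) :
    torusSum θ (e K r) = (((p : K) - 1) / p) • traceVector θ r := by
  have hp0 := natCast_prime_ne_zero p K
  set F : ZMod p → Model p K := fun m => ∑ y : nonsplitTorus p u,
    charValue θ y • e K ((m + r) * nm y / (m ^ 2 - u) + tr y + m) with hF
  have h1 : ∀ t : nonsplitTorus p u, act θ t.1 (e K r)
      = if t.1 1 0 = 0 then e K r else (-(1 / (p : K))) • F (t.1 0 0 / t.1 1 0) := fun t => by
    split_ifs with ht
    · rw [act_scalar θ ht, Module.End.one_apply]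
    · rw [act_e θ ht, hF]
      congr 1
      rw [← Equiv.sum_comp (Equiv.mulRight (mkScalar _ (neg_ne_zero.2 ht)))]
      refine Finset.sum_congr rfl fun y _ => ?_
      rw [Equiv.coe_mulRight, charValue_mul, charValue_mkScalar, mul_one, nm_mul, nm_mkScalar,
        tr_mul_mkScalar, t.2.1, ← nm, nm_eq t]
      congr 2
      have h2 : t.1 0 0 ^ 2 - u * t.1 1 0 ^ 2 ≠ 0 := nm_eq t ▸ nm_ne_zero t
      have h3 : (t.1 0 0 / t.1 1 0) ^ 2 - u ≠ 0 := by
        rw [div_pow, div_sub' (pow_ne_zero 2 ht)]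
        exact div_ne_zero (by rwa [mul_comm _ u]) (pow_ne_zero 2 ht)
      have h4 : (t.1 0 0 / t.1 1 0) ^ 2 - u = (t.1 0 0 ^ 2 - u * t.1 1 0 ^ 2) / t.1 1 0 ^ 2 := by
        field_simp
      rw [h4]
      field_simp
      ring
  have h2 := sum_torus hu (fun a b => if b = 0 then e K r else (-(1 / (p : K))) • F (a / b))
  have h3 : ∀ b : ZMod p, b ≠ 0 → ∑ a, (if b = 0 then e K r else (-(1 / (p : K))) • F (a / b))
      = (-(1 / (p : K))) • ∑ m, F m := fun b hb => by
    simp only [if_neg hb]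
    rw [← Finset.smul_sum]
    congr 1
    exact Fintype.sum_equiv (Equiv.divRight₀ b hb) _ _ fun a => rfl
  rw [Finset.sum_comm, Fintype.sum_eq_add_sum_compl (0 : ZMod p),
    Finset.sum_congr rfl fun b hb => h3 b (by simpa using hb)] at h2
  simp only [if_true, Finset.sum_const, Finset.card_univ, Finset.card_compl,
    Finset.card_singleton, ZMod.card, ← h1] at h2
  rw [← LinearMap.sum_apply, ← torusSum, ← Nat.cast_smul_eq_nsmul K, ← Nat.cast_smul_eq_nsmul K,
    Nat.cast_sub (Fact.out : p.Prime).one_lt.le, Nat.cast_one] at h2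
  rw [← sub_eq_iff_eq_add'.2 h2, traceVector]
  match_scalars <;> field_simp

theorem exists_span_traceVector (hu : ¬IsSquare u) (θ : TorusModScalars p u →* Kˣ)
    (hθ : θ ^ 2 ≠ 1) : ∃ r : ZMod p, r ≠ 0 ∧
      invariantsOf (cuspidalRep hu θ hθ) (nonsplitTorus p u)
        = Submodule.span K {traceVector θ r} := by
  have hp0 := natCast_prime_ne_zero p K
  have hp1 : (p : K) - 1 ≠ 0 := sub_ne_zero.2 (by exact_mod_cast (Fact.out : p.Prime).one_lt.ne')
  have hfin := finrank_invariantsOf_torus hu θ hθ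
  obtain ⟨r, hr, hne⟩ : ∃ r : ZMod p, r ≠ 0 ∧ torusSum θ (e K r) ≠ 0 := by
    by_contra! h
    -- The case `r = 0` follows from the others because the `e_r` sum to zero; this is why `r` can
    -- be taken nonzero.
    have h0 : torusSum θ (e K (0 : ZMod p)) = 0 := by
      have h1 := congrArg (torusSum θ) (sum_e (p := p) (K := K))
      rw [map_zero, map_sum, Fintype.sum_eq_single _ h] at h1
      exact h1
    have h2 : torusSum θ = (0 : Module.End K (Model p K)) := end_ext fun r => by
      rw [LinearMap.zero_apply]
      by_cases hr : r = 0
      · rw [hr, h0]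
      · exact h r hr
    obtain ⟨v, hv, -⟩ := finrank_eq_one_iff'.1 hfin
    have h3 := torusSum_of_mem v.2
    rw [h2, LinearMap.zero_apply, eq_comm, smul_eq_zero] at h3
    exact hv (Subtype.ext (h3.resolve_left (card_torus_ne_zero u K)))
  refine ⟨r, hr, ?_⟩
  have hmem := torusSum_mem hu θ hθ (e K r)
  rw [torusSum_e hu] at hne hmem
  have hmem' : traceVector θ r ∈ invariantsOf (cuspidalRep hu θ hθ) (nonsplitTorus p u) :=
    (Submodule.smul_mem_iff _ (div_ne_zero hp1 hp0)).1 hmem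
  symm
  refine Submodule.eq_of_le_of_finrank_eq ?_ ?_
  · rwa [Submodule.span_singleton_le_iff_mem]
  · rw [hfin, finrank_span_singleton (right_ne_zero_of_smul hne)]

theorem normalizer_nonsplitTorus_fixes_iff (hu : ¬IsSquare u) (θ : TorusModScalars p u →* Kˣ)
    (hθ : θ ^ 2 ≠ 1) :
    (∀ g ∈ Subgroup.normalizer (nonsplitTorus p u : Set (GL (Fin 2) (ZMod p))),
      ∀ v ∈ invariantsOf (cuspidalRep hu θ hθ) (nonsplitTorus p u),
        cuspidalRep hu θ hθ g v = v) ↔ IsOdd θ := by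
  rw [isOdd_iff hu]
  constructor
  · intro h
    obtain ⟨v, hv, -⟩ := finrank_eq_one_iff'.1 (finrank_invariantsOf_torus hu θ hθ)
    have h1 : act θ (reflection p) v = v := h _ (reflection_mem_normalizer u) v v.2
    rw [act_reflection_of_mem v.2] at h1
    have h2 : (-charValue θ (sqrtU hu) - 1) • (v : Model p K) = 0 := by
      rw [sub_smul, h1, one_smul, sub_self]
    have h3 := (smul_eq_zero.1 h2).resolve_right fun h => hv (Subtype.ext h)
    linear_combination -h3
  · intro h g hg v hv
    change act θ g v = v
    rcases mem_or_mem_of_mem_normalizer hu hg with h1 | h1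
    · exact mem_invariantsOf.1 hv g h1
    · have h2 : g = reflection p * (reflection p * g) := by
        rw [← mul_assoc, reflection_mul_self, one_mul]
      rw [h2, act_mul hu θ hθ, Module.End.mul_apply, mem_invariantsOf.1 hv _ h1,
        act_reflection_of_mem hv, h, neg_neg, one_smul]

/-! ### Invariants of the unipotent group and of the split torus -/

theorem invariantsOf_unipotents (hu : ¬IsSquare u) (θ : TorusModScalars p u →* Kˣ)
    (hθ : θ ^ 2 ≠ 1) : invariantsOf (cuspidalRep hu θ hθ) (unipotents p) = ⊥ := by
  rw [eq_bot_iff]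
  intro v hv
  rw [mem_invariantsOf] at hv
  have h : ∀ x : ZMod p, borel K 1 x 1 v = v := fun x => by
    have h1 := hv (Matrix.GeneralLinearGroup.mkOfDetNeZero !![1, x; 0, 1]
      (by rw [Matrix.det_fin_two_of]; simp))
      (by simp [unipotents, Matrix.GeneralLinearGroup.mkOfDetNeZero])
    rw [act_of_eq_zero θ (by simp [Matrix.GeneralLinearGroup.mkOfDetNeZero])] at h1
    simpa [Matrix.GeneralLinearGroup.mkOfDetNeZero] using h1
  -- The translates of `e_r` run over all the `e_s`, whose sum is a constant function.
  have h2 : ∑ x : ZMod p, borel K 1 x 1 = 0 := end_ext fun r => by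
    simp only [LinearMap.sum_apply, borel_e one_ne_zero one_ne_zero, LinearMap.zero_apply]
    rw [← sum_e_affine (K := K) (one_ne_zero (α := ZMod p)) r]
    exact Finset.sum_congr rfl fun x _ => by congr 1; ring
  have h3 := congrArg (fun f => f v) h2
  simp only [LinearMap.sum_apply, h, Finset.sum_const, Finset.card_univ, ZMod.card,
    LinearMap.zero_apply] at h3
  rw [← Nat.cast_smul_eq_nsmul K] at h3
  exact (smul_eq_zero.1 h3).resolve_left (natCast_prime_ne_zero p K)

theorem natCast_sub_one_ne_zero (p : ℕ) [Fact p.Prime] (K : Type*) [Field K] [CharZero K] :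
    (p : K) - 1 ≠ 0 :=
  sub_ne_zero.2 (by exact_mod_cast (Fact.out : p.Prime).one_lt.ne')

/-- Scaling `y` by `a` leaves `θ(y)` alone and dilates the trace. Averaging over `a ≠ 0` puts every
term on the line of `e_0`; since `∑ θ(y) = 0`, only the `y` of trace zero survive. -/
theorem sum_charValue_e_tr (hu : ¬IsSquare u) (θ : TorusModScalars p u →* Kˣ)
    (hθ : θ ^ 2 ≠ 1) :
    ∑ y : nonsplitTorus p u, charValue θ y • e K (tr y)
      = ((p : K) * charValue θ (sqrtU hu)) • e K (0 : ZMod p) := by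
  have h1 : ∀ a ∈ ({0}ᶜ : Finset (ZMod p)), ∑ y : nonsplitTorus p u, charValue θ y • e K (tr y)
      = ∑ y : nonsplitTorus p u, charValue θ y • e K (a * tr y) := fun a ha => by
    have ha0 : a ≠ 0 := by simpa using ha
    rw [← Equiv.sum_comp (Equiv.mulRight (mkScalar a ha0))]
    refine Finset.sum_congr rfl fun y _ => ?_
    rw [Equiv.coe_mulRight, charValue_mul, charValue_mkScalar, mul_one, tr_mul_mkScalar]
  have h2 := Finset.sum_congr rfl h1
  have h3 : ∀ y : nonsplitTorus p u, charValue θ y * ((if tr y = 0 then (p : K) else 0) - 1)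
      = (if y.1 0 0 = 0 then (p : K) * charValue θ (sqrtU hu) else 0) - charValue θ y := by
    intro y
    simp only [tr_eq, mul_eq_zero, two_ne_zero_of hu, false_or]
    split_ifs with h
    · rw [charValue_of_zero hu θ h]
      ring
    · ring
  rw [Finset.sum_const, Finset.sum_comm] at h2
  simp only [← Finset.smul_sum, sum_e_dilation, smul_smul, ← Finset.sum_smul, h3,
    Finset.sum_sub_distrib, sum_zero_entry hu, sum_charValue θ hθ, sub_zero] at h2
  rw [Finset.card_compl, Finset.card_singleton, ZMod.card,
    ← Nat.cast_smul_eq_nsmul K, Nat.cast_sub (Fact.out : p.Prime).one_lt.le, Nat.cast_one,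
    mul_smul] at h2
  exact smul_right_injective _ (natCast_sub_one_ne_zero p K) h2

theorem wAct_e_zero (hu : ¬IsSquare u) (θ : TorusModScalars p u →* Kˣ) (hθ : θ ^ 2 ≠ 1) :
    wAct θ (e K (0 : ZMod p)) = -charValue θ (sqrtU hu) • e K (0 : ZMod p) := by
  have hp0 := natCast_prime_ne_zero p K
  simp only [wAct_e, mul_zero, zero_add]
  rw [sum_charValue_e_tr hu θ hθ, smul_smul]
  congr 1
  field_simp

theorem diag_entries_ne_zero {g : GL (Fin 2) (ZMod p)} (hg : g ∈ splitTorus p) :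
    g 0 0 ≠ 0 ∧ g 1 1 ≠ 0 := by
  have hD := (Matrix.isUnits_det_units g).ne_zero
  rw [Matrix.det_fin_two, hg.1, zero_mul, sub_zero] at hD
  exact ⟨left_ne_zero_of_mul hD, right_ne_zero_of_mul hD⟩

theorem invariantsOf_splitTorus (hu : ¬IsSquare u) (θ : TorusModScalars p u →* Kˣ)
    (hθ : θ ^ 2 ≠ 1) :
    invariantsOf (cuspidalRep hu θ hθ) (splitTorus p) = Submodule.span K {e K 0} := by
  apply le_antisymm
  · intro v hv
    rw [mem_invariantsOf] at hv
    have h : ∀ a ∈ ({0}ᶜ : Finset (ZMod p)), borel K a 0 1 v = v := fun a ha => by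
      have h1 := hv (Matrix.GeneralLinearGroup.mkOfDetNeZero !![a, 0; 0, 1]
        (by rw [Matrix.det_fin_two_of]; simpa using ha))
        (by simp [splitTorus, Matrix.GeneralLinearGroup.mkOfDetNeZero])
      rw [act_of_eq_zero θ (by simp [Matrix.GeneralLinearGroup.mkOfDetNeZero])] at h1
      simpa [Matrix.GeneralLinearGroup.mkOfDetNeZero] using h1
    -- The sum of the dilations maps the whole model into the line of `e_0`, while it multiplies `v`
    -- by `p - 1`.
    have h2 : (⊤ : Submodule K (Model p K)) ≤ (Submodule.span K {e K (0 : ZMod p)}).comap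
        (∑ a ∈ ({0}ᶜ : Finset (ZMod p)), borel K a 0 1) := by
      rw [← span_range_e, Submodule.span_le]
      rintro _ ⟨r, rfl⟩
      have h3 : ∑ a ∈ ({0}ᶜ : Finset (ZMod p)), borel K a 0 1 (e K r)
          = ∑ a ∈ ({0}ᶜ : Finset (ZMod p)), e K (a * r) :=
        Finset.sum_congr rfl fun a ha => by
          rw [borel_e (by simpa using ha) one_ne_zero, add_zero, div_one]
      rw [SetLike.mem_coe, Submodule.mem_comap, LinearMap.sum_apply, h3, sum_e_dilation]
      exact Submodule.smul_mem _ _ (Submodule.mem_span_singleton_self _)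
    have h3 := h2 (Submodule.mem_top (x := v))
    rw [Submodule.mem_comap, LinearMap.sum_apply, Finset.sum_congr rfl h, Finset.sum_const,
      Finset.card_compl, Finset.card_singleton, ZMod.card, ← Nat.cast_smul_eq_nsmul K,
      Nat.cast_sub (Fact.out : p.Prime).one_lt.le, Nat.cast_one] at h3
    exact (Submodule.smul_mem_iff _ (natCast_sub_one_ne_zero p K)).1 h3
  · rw [Submodule.span_singleton_le_iff_mem, mem_invariantsOf]
    intro g hg
    obtain ⟨ha, hd⟩ := diag_entries_ne_zero hg
    rw [act_of_eq_zero θ hg.2, borel_e ha hd, hg.1, mul_zero, add_zero, zero_div]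

theorem act_antidiagonal (hu : ¬IsSquare u) (θ : TorusModScalars p u →* Kˣ) (hθ : θ ^ 2 ≠ 1)
    {g : GL (Fin 2) (ZMod p)} (h0 : g 0 0 = 0) (h1 : g 1 1 = 0) :
    act θ g (e K 0) = -charValue θ (sqrtU hu) • e K (0 : ZMod p) := by
  have hD := (Matrix.isUnits_det_units g).ne_zero
  have hc : g 1 0 ≠ 0 := by
    intro h
    rw [Matrix.det_fin_two, h0, h] at hD
    simp at hD
  rw [act_of_ne_zero θ hc, h0, h1, zero_div, borel_one, one_mul, Module.End.mul_apply,
    borel_e (neg_ne_zero.2 hc) (neg_ne_zero.2 (div_ne_zero hD hc)), mul_zero, neg_zero, add_zero,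
    zero_div, wAct_e_zero hu θ hθ]

/-- The conjugate of `diag(1, -1)` by `g` is diagonal with the same eigenvalues `1` and `-1`, which
`g` either keeps in order or swaps. The two cases are told apart by whether the upper left entry of
`g` vanishes. -/
theorem mem_or_antidiagonal_of_mem_normalizer (hu : ¬IsSquare u) {g : GL (Fin 2) (ZMod p)}
    (hg : g ∈ Subgroup.normalizer (splitTorus p : Set (GL (Fin 2) (ZMod p)))) :
    g ∈ splitTorus p ∨ g 0 0 = 0 ∧ g 1 1 = 0 := by
  have h2 := two_ne_zero_of hu
  obtain ⟨r1, r2, r3, r4⟩ := reflection_entries (p := p)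
  have ht := (Subgroup.mem_normalizer_iff.1 hg (reflection p)).1 ⟨r2, r3⟩
  set t := g * reflection p * g⁻¹ with h_t
  have h1 : t * g = g * reflection p := by
    rw [h_t]
    exact inv_mul_cancel_right _ _
  have e00 := congrArg (fun m : GL (Fin 2) (ZMod p) => m 0 0) h1
  have e01 := congrArg (fun m : GL (Fin 2) (ZMod p) => m 0 1) h1
  have e10 := congrArg (fun m : GL (Fin 2) (ZMod p) => m 1 0) h1
  have e11 := congrArg (fun m : GL (Fin 2) (ZMod p) => m 1 1) h1
  simp only [mul_entry, ht.1, ht.2, r1, r2, r3, r4, zero_mul, mul_zero, add_zero, zero_add,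
    mul_one] at e00 e01 e10 e11
  have hD := (Matrix.isUnits_det_units g).ne_zero
  rw [Matrix.det_fin_two] at hD
  by_cases h0 : g 0 0 = 0
  · right
    have hc : g 1 0 ≠ 0 := by
      intro h
      rw [h0, h] at hD
      simp at hD
    have h3 : t 1 1 = 1 := mul_right_cancel₀ hc (by rw [e10, one_mul])
    rw [h3] at e11
    exact ⟨h0, (mul_eq_zero.1 (by linear_combination e11 : 2 * g 1 1 = 0)).resolve_left h2⟩
  · left
    have h3 : t 0 0 = 1 := mul_right_cancel₀ h0 (by rw [e00, one_mul])
    rw [h3] at e01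
    have h01 := (mul_eq_zero.1 (by linear_combination e01 : 2 * g 0 1 = 0)).resolve_left h2
    have hd : g 1 1 ≠ 0 := by
      intro h
      rw [h01, h] at hD
      simp at hD
    have h4 : t 1 1 = -1 := mul_right_cancel₀ hd (by rw [e11]; ring)
    rw [h4] at e10
    exact ⟨h01, (mul_eq_zero.1 (by linear_combination -e10 : 2 * g 1 0 = 0)).resolve_left h2⟩

theorem normalizer_splitTorus_fixes_iff (hu : ¬IsSquare u) (θ : TorusModScalars p u →* Kˣ)
    (hθ : θ ^ 2 ≠ 1) :
    (∀ g ∈ Subgroup.normalizer (splitTorus p : Set (GL (Fin 2) (ZMod p))),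
      ∀ v ∈ invariantsOf (cuspidalRep hu θ hθ) (splitTorus p),
        cuspidalRep hu θ hθ g v = v) ↔ IsOdd θ := by
  rw [isOdd_iff hu]
  constructor
  · intro h
    set w : GL (Fin 2) (ZMod p) := Matrix.GeneralLinearGroup.mkOfDetNeZero !![0, 1; -1, 0]
      (by rw [Matrix.det_fin_two_of]; simp) with hw
    have w00 : w 0 0 = 0 := by simp [hw, Matrix.GeneralLinearGroup.mkOfDetNeZero]
    have w01 : w 0 1 = 1 := by simp [hw, Matrix.GeneralLinearGroup.mkOfDetNeZero]
    have w10 : w 1 0 = -1 := by simp [hw, Matrix.GeneralLinearGroup.mkOfDetNeZero]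
    have w11 : w 1 1 = 0 := by simp [hw, Matrix.GeneralLinearGroup.mkOfDetNeZero]
    have hmem : w ∈ Subgroup.normalizer (splitTorus p : Set (GL (Fin 2) (ZMod p))) := by
      refine Subgroup.mem_normalizer_iff'.2 fun n => ?_
      change ((n * w) 0 1 = 0 ∧ (n * w) 1 0 = 0) ↔ ((w * n) 0 1 = 0 ∧ (w * n) 1 0 = 0)
      simp only [mul_entry, w00, w01, w10, w11]
      simp [and_comm]
    have h1 : act θ w (e K 0) = e K 0 := h w hmem _ (by
      rw [invariantsOf_splitTorus]
      exact Submodule.mem_span_singleton_self _)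
    rw [act_antidiagonal hu θ hθ w00 w11] at h1
    have h2 : (-charValue θ (sqrtU hu) - 1) • e K (0 : ZMod p) = 0 := by
      rw [sub_smul, h1, one_smul, sub_self]
    have h3 := (smul_eq_zero.1 h2).resolve_right (e_ne_zero 0)
    linear_combination -h3
  · intro h g hg v hv
    change act θ g v = v
    rcases mem_or_antidiagonal_of_mem_normalizer hu hg with h1 | h1
    · exact mem_invariantsOf.1 hv g h1
    · rw [invariantsOf_splitTorus] at hv
      obtain ⟨c, rfl⟩ := Submodule.mem_span_singleton.1 hv
      rw [map_smul, act_antidiagonal hu θ hθ h1.1 h1.2, h, neg_neg, one_smul]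

end

end CuspidalModel

open CuspidalModel in
theorem proposition5p1 {p : ℕ} [Fact p.Prime] (hp : 2 < p) {u : ZMod p} (hu : ¬IsSquare u)
    {K : Type*} [Field K] [CharZero K] (θ : TorusModScalars p u →* Kˣ) (hθ : θ ^ 2 ≠ 1) :
    -- the invariants of the unipotent group
    invariantsOf (cuspidalRep hu θ hθ) (unipotents p) = ⊥ ∧
    -- the invariants of the split torus
    (invariantsOf (cuspidalRep hu θ hθ) (splitTorus p) = Submodule.span K {e K 0} ∧
      ((∀ g ∈ Subgroup.normalizer (splitTorus p : Set (GL (Fin 2) (ZMod p))),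
          ∀ v ∈ invariantsOf (cuspidalRep hu θ hθ) (splitTorus p),
            cuspidalRep hu θ hθ g v = v) ↔ IsOdd θ)) ∧
    -- the invariants of the non-split torus
    (Module.finrank K (invariantsOf (cuspidalRep hu θ hθ) (nonsplitTorus p u)) = 1 ∧
      (∃ r : ZMod p, r ≠ 0 ∧
        invariantsOf (cuspidalRep hu θ hθ) (nonsplitTorus p u)
          = Submodule.span K {traceVector θ r}) ∧
      ((∀ g ∈ Subgroup.normalizer (nonsplitTorus p u : Set (GL (Fin 2) (ZMod p))),
          ∀ v ∈ invariantsOf (cuspidalRep hu θ hθ) (nonsplitTorus p u),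
            cuspidalRep hu θ hθ g v = v) ↔ IsOdd θ)) :=
  ⟨invariantsOf_unipotents hu θ hθ,
    ⟨invariantsOf_splitTorus hu θ hθ, normalizer_splitTorus_fixes_iff hu θ hθ⟩,
    finrank_invariantsOf_torus hu θ hθ, exists_span_traceVector hu θ hθ,
    normalizer_nonsplitTorus_fixes_iff hu θ hθ⟩
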